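/- Let $k$ be a non-Archimedean local field which is neither of characteristic $2$ nor an extension of $\mathbb Q_2$. Let $\mathcal O$ be its ring of integers, $\varpi$ a generator of the maximal ideal of $\mathcal O$, $q$ the cardinality of the residue field $\mathcal O/\varpi\mathcal O$, $dt$ the Haar measure of $(k,+)$ with $\mathrm{Vol}(\mathcal O)=1$, and $\Psi$ a unitary character of $(k,+)$ that is trivial on $\mathcal O$ but not on $\varpi^{-1}\mathcal O$. For an integer $n\ge 1$ let $U_n=1+\varpi^n\mathcal O$, with the Haar measure $da$ obtained by restricting $dt$, let $\Gamma_n=k/\varpi^{-n}\mathcal O$ (a discrete group), and let $X_n=U_n\ltimes\Gamma_n$ be the locally compact group of pairs $(a,[t])$ with $a\in U_n$, $[t]\in\Gamma_n$ and group law $$(a,[t])\,(a',[t'])=(aa',[a'^{-1}t+t']).$$ Let $d[g]$ be the product of $da$ and of the counting measure of $\Gamma_n$, and let $\lambda_g f(g')=f(g^{-1}g')$ be the left translations. Put $\phi(a)=a-a^{-1}$ for $a\in U_n$, and let $\mathcal D(X_n\times X_n)$ be the space of locally constant, compactly supported functions $X_n\times X_n\to\mathbb C$. Consider the convolution operator $$F=q^{2n}\int_{X_n\times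 X_n}\Psi\big(\phi(a_1)t_2-\phi(a_2)t_1\big)\;\lambda_{g_1^{-1}}\otimes\lambda_{g_2^{-1}}\;d[g_1]\,d[g_2],\qquad g_j=(a_j,[t_j]),$$ defined as a form on $\mathcal D(X_n\times X_n)\subset L^2(X_n\times X_n)$ by $$\langle h,Ff\rangle=q^{2n}\int_{X_n\times X_n}\Psi\big(\phi(a_1)t_2-\phi(a_2)t_1\big)\,\big\langle h,(\lambda_{g_1^{-1}}\otimes\lambda_{g_2^{-1}})f\big\rangle\,d[g_1]\,d[g_2],\qquad h,f\in\mathcal D(X_n\times X_n).$$ Then these integrals converge absolutely, and $F$ extends to a unitary operator on $L^2(X_n\times X_n)$, which is the only bounded operator that extends $F$. -/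

import Mathlib

open MeasureTheory ValuativeRel

noncomputable section

namespace FuchsCocycle

/-- The Bruhat space `𝓓(Y)` of a totally disconnected locally compact space `Y`: the locally
constant, compactly supported, complex valued functions. -/
def IsBruhat {Y : Type*} [TopologicalSpace Y] (f : Y → ℂ) : Prop :=
  IsLocallyConstant f ∧ HasCompactSupport f

section Field

variable {k : Type*} [Field k] [ValuativeRel k]

/-- The group `U_n = 1 + ϖⁿ 𝒪` of higher principal units, for `n ≥ 1`, inside `𝒪ˣ`. -/
def U (ϖ : 𝒪[k]) (n : ℕ) : Subgroup 𝒪[k]ˣ where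
  carrier := {u | ∃ x : 𝒪[k], (u : 𝒪[k]) = 1 + ϖ ^ n * x}
  one_mem' := ⟨0, by simp⟩
  mul_mem' := by
    rintro u v ⟨x, hx⟩ ⟨y, hy⟩
    exact ⟨x + y + ϖ ^ n * x * y, by rw [Units.val_mul, hx, hy]; ring⟩
  inv_mem' := by
    rintro u ⟨x, hx⟩
    refine ⟨-((u⁻¹ : 𝒪[k]ˣ) : 𝒪[k]) * x, ?_⟩
    have h : ((u⁻¹ : 𝒪[k]ˣ) : 𝒪[k]) * (1 + ϖ ^ n * x) = 1 := by
      rw [← hx, Units.inv_mul]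
    linear_combination h

/-- The fractional ideal `ϖ⁻ⁿ 𝒪`, as an `𝒪`-submodule of `k`. -/
def fracIdeal (ϖ : 𝒪[k]) (n : ℕ) : Submodule 𝒪[k] k :=
  Submodule.span 𝒪[k] {((ϖ : k) ^ n)⁻¹}

/-- The group `Γ_n = k / ϖ⁻ⁿ 𝒪`; the units `U_n` act on it by dilations `a • [t] = [a t]`. -/
abbrev Gam (ϖ : 𝒪[k]) (n : ℕ) : Type _ := k ⧸ fracIdeal ϖ n

/-- The inclusion `U_n → k`. -/
def U.toField {ϖ : 𝒪[k]} {n : ℕ} (a : U ϖ n) : k := (((a : 𝒪[k]ˣ) : 𝒪[k]) : k)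

/-- The function `φ(a) = a - a⁻¹` on `U_n`. -/
def phi {ϖ : 𝒪[k]} {n : ℕ} (a : U ϖ n) : k := U.toField a - (U.toField a)⁻¹

/-- The group `X_n = U_n ⋉ Γ_n`, with elements `(a, [t])`. -/
@[ext] structure X (ϖ : 𝒪[k]) (n : ℕ) where
  /-- the component in `U_n` -/
  a : U ϖ n
  /-- the component in `Γ_n` -/
  t : Gam ϖ n

/-- The bijection between `X_n` and the set `U_n × Γ_n`. -/
def X.equivProd (ϖ : 𝒪[k]) (n : ℕ) : X ϖ n ≃ U ϖ n × Gam ϖ n where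
  toFun g := (g.a, g.t)
  invFun p := ⟨p.1, p.2⟩
  left_inv _ := rfl
  right_inv _ := rfl

variable {ϖ : 𝒪[k]} {n : ℕ}

/-- The group law `(a, [t]) (a', [t']) = (a a', [a'⁻¹ t + t'])`. -/
instance : Mul (X ϖ n) := ⟨fun g g' => ⟨g.a * g'.a, g'.a⁻¹ • g.t + g'.t⟩⟩
instance : One (X ϖ n) := ⟨⟨1, 0⟩⟩
instance : Inv (X ϖ n) := ⟨fun g => ⟨g.a⁻¹, -(g.a • g.t)⟩⟩

@[simp] theorem X.mul_a (g g' : X ϖ n) : (g * g').a = g.a * g'.a := rfl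
@[simp] theorem X.mul_t (g g' : X ϖ n) : (g * g').t = g'.a⁻¹ • g.t + g'.t := rfl
@[simp] theorem X.one_a : (1 : X ϖ n).a = 1 := rfl
@[simp] theorem X.one_t : (1 : X ϖ n).t = 0 := rfl
@[simp] theorem X.inv_a (g : X ϖ n) : (g⁻¹).a = g.a⁻¹ := rfl
@[simp] theorem X.inv_t (g : X ϖ n) : (g⁻¹).t = -(g.a • g.t) := rfl

instance : Group (X ϖ n) :=
  Group.ofLeftAxioms
    (by intro x y z; ext1 <;> simp [mul_assoc, mul_smul, add_assoc])
    (by intro x; ext1 <;> simp)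
    (by intro x; ext1 <;> simp)

/-- The left translation `(λ_{g₁} ⊗ λ_{g₂}) f (g₁', g₂') = f (g₁⁻¹ g₁', g₂⁻¹ g₂')` of functions
on `X_n × X_n`. -/
def leftTranslate (g : X ϖ n × X ϖ n) (f : X ϖ n × X ϖ n → ℂ) : X ϖ n × X ϖ n → ℂ :=
  fun g' => f (g.1⁻¹ * g'.1, g.2⁻¹ * g'.2)

/-- The phase `Ψ(φ(a₁) t₂ - φ(a₂) t₁)` at `(g₁, g₂)`, computed with representatives `t₁`, `t₂` of
the classes; `phase_eq` shows that the choice does not matter. -/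
def phase (Ψ : AddChar k Circle) (g : X ϖ n × X ϖ n) : ℂ :=
  (Ψ (phi g.1.a * Quotient.out g.2.t - phi g.2.a * Quotient.out g.1.t) : ℂ)

end Field

section Lemmas

variable {k : Type*} [Field k] [ValuativeRel k] {ϖ : 𝒪[k]} {n : ℕ}

theorem phi_mul_mem (hϖ : ϖ ≠ 0) (a : U ϖ n) {s : k} (hs : s ∈ fracIdeal ϖ n) :
    phi a * s ∈ 𝒪[k] := by
  obtain ⟨a, x, hx⟩ := a
  obtain ⟨y, rfl⟩ := Submodule.mem_span_singleton.mp hs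
  have hϖ' : (ϖ : k) ^ n ≠ 0 := pow_ne_zero _ (by simpa using hϖ)
  obtain ⟨z, hz⟩ := (U ϖ n).inv_mem (x := a) ⟨x, hx⟩
  have h1 : ((a : 𝒪[k]) : k) = 1 + (ϖ : k) ^ n * x := by
    rw [hx]; simp
  have h2 : (((a⁻¹ : 𝒪[k]ˣ) : 𝒪[k]) : k) = 1 + (ϖ : k) ^ n * z := by
    rw [hz]; simp
  have h3 : ((a : 𝒪[k]) : k)⁻¹ = (((a⁻¹ : 𝒪[k]ˣ) : 𝒪[k]) : k) := by
    apply inv_eq_of_mul_eq_one_right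
    rw [← Subring.coe_mul, Units.mul_inv, Subring.coe_one]
  have : phi (⟨a, x, hx⟩ : U ϖ n) * (y • ((ϖ : k) ^ n)⁻¹) = (((x - z) * y : 𝒪[k]) : k) := by
    simp only [phi, U.toField, h3]
    rw [h1, h2, Subring.smul_def, smul_eq_mul]
    push_cast
    field_simp
    ring
  rw [this]
  exact Subtype.property _

/-- The phase does not depend on the representatives. -/
theorem phase_eq (hϖ : ϖ ≠ 0) (Ψ : AddChar k Circle) (hΨ : ∀ x ∈ 𝒪[k], Ψ x = 1)
    (a₁ a₂ : U ϖ n) (t₁ t₂ : k) :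
    phase Ψ ((⟨a₁, Submodule.Quotient.mk t₁⟩, ⟨a₂, Submodule.Quotient.mk t₂⟩) : X ϖ n × X ϖ n) =
      (Ψ (phi a₁ * t₂ - phi a₂ * t₁) : ℂ) := by
  have key : ∀ (a : U ϖ n) (t : k), ∃ w ∈ 𝒪[k],
      phi a * Quotient.out (Submodule.Quotient.mk t : Gam ϖ n) = phi a * t + w := by
    intro a t
    refine ⟨_, phi_mul_mem hϖ a (s := Quotient.out (Submodule.Quotient.mk t : Gam ϖ n) - t) ?_,
      by ring⟩
    rw [← Submodule.Quotient.eq]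
    exact Quotient.out_eq _
  obtain ⟨w, hw, h⟩ := key a₁ t₂
  obtain ⟨w', hw', h'⟩ := key a₂ t₁
  simp only [phase]
  rw [h, h']
  have e : phi a₁ * t₂ + w - (phi a₂ * t₁ + w') = (phi a₁ * t₂ - phi a₂ * t₁) + (w - w') := by ring
  rw [e, AddChar.map_add_eq_mul, hΨ _ (sub_mem hw hw'), mul_one]

end Lemmas

section Measure

variable {k : Type*} [Field k] [ValuativeRel k] [TopologicalSpace k] {ϖ : 𝒪[k]} {n : ℕ}

/-- The topology of `X_n`: the product of the topology of `U_n` and the quotient topology of `Γ_n`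
(which is discrete, as `ϖ⁻ⁿ 𝒪` is open in `k`). -/
instance : TopologicalSpace (X ϖ n) :=
  TopologicalSpace.induced (X.equivProd ϖ n) inferInstance

variable [MeasurableSpace k]

/-- The `σ`-algebra of `X_n`: the product of those of `U_n` and of `Γ_n`. -/
instance : MeasurableSpace (X ϖ n) :=
  MeasurableSpace.comap (X.equivProd ϖ n) inferInstance

/-- The Haar measure `da` of `U_n`: the restriction of the additive Haar measure `μ` of `k`. -/
def haarU (μ : Measure k) (ϖ : 𝒪[k]) (n : ℕ) : Measure (U ϖ n) :=
  μ.comap U.toField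

/-- The Haar measure `d[g]` of `X_n`: the product of the Haar measure of `U_n` and the counting
measure of `Γ_n`. -/
def haarX (μ : Measure k) (ϖ : 𝒪[k]) (n : ℕ) : Measure (X ϖ n) :=
  ((haarU μ ϖ n).prod Measure.count).comap (X.equivProd ϖ n)

/-- The measure `d[g₁] d[g₂]` of `X_n × X_n`. -/
abbrev haarXX (μ : Measure k) (ϖ : 𝒪[k]) (n : ℕ) : Measure (X ϖ n × X ϖ n) :=
  (haarX μ ϖ n).prod (haarX μ ϖ n)

/-- The integrand of the form of `F` at `(h, f)`: the function
`(g₁, g₂) ↦ Ψ(φ(a₁) t₂ - φ(a₂) t₁) ⟨h, (λ_{g₁⁻¹} ⊗ λ_{g₂⁻¹}) f⟩`, where the scalar product is that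
of `L²(X_n × X_n)`, conjugate linear in `h`. -/
def cocycleIntegrand (μ : Measure k) (Ψ : AddChar k Circle) (h f : X ϖ n × X ϖ n → ℂ)
    (g : X ϖ n × X ϖ n) : ℂ :=
  phase Ψ g * ∫ g', starRingEnd ℂ (h g') * leftTranslate (g.1⁻¹, g.2⁻¹) f g' ∂(haarXX μ ϖ n)

/-- The convolution operator
`F = q^{2n} ∫ Ψ(φ(a₁) t₂ - φ(a₂) t₁) λ_{g₁⁻¹} ⊗ λ_{g₂⁻¹} d[g₁] d[g₂]` as a form:
`cocycleForm μ Ψ h f` is `⟨h, F f⟩`. -/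
def cocycleForm (μ : Measure k) (Ψ : AddChar k Circle) (h f : X ϖ n × X ϖ n → ℂ) : ℂ :=
  (Nat.card 𝓀[k] : ℂ) ^ (2 * n) * ∫ g, cocycleIntegrand μ Ψ h f g ∂(haarXX μ ϖ n)

/-- The bounded operator `T` of `L²(X_n × X_n)` extends `F`, which is given as a form on the
Bruhat space `𝓓(X_n × X_n)`. -/
def ExtendsCocycle (μ : Measure k) (Ψ : AddChar k Circle)
    (T : Lp ℂ 2 (haarXX μ ϖ n) →L[ℂ] Lp ℂ 2 (haarXX μ ϖ n)) : Prop :=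
  ∀ h f : X ϖ n × X ϖ n → ℂ, IsBruhat h → IsBruhat f →
    ∀ v u : Lp ℂ 2 (haarXX μ ϖ n), v =ᵐ[haarXX μ ϖ n] h → u =ᵐ[haarXX μ ϖ n] f →
      inner ℂ v (T u) = cocycleForm μ Ψ h f

end Measure

end FuchsCocycle

end

/-!
The substitutions `aⱼ ↦ aⱼ bⱼ` and `tⱼ ↦ bⱼ (tⱼ - sⱼ)` show that `F` is, up to a Fourier transform
in the variables of `Γ_n`, a change of variables on `U_n² × (ϖⁿ 𝒪)²`. All of this takes place at
finite levels, where neither Fourier transforms nor Jacobians are needed.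

For `M ≥ n` let `H = (U_n ⋉ ϖ⁻ᴹ 𝒪 / ϖ⁻ⁿ 𝒪)²` and `K = (U_M ⋉ 0)²`. As `U_M` acts trivially on
`ϖ⁻ᴹ 𝒪 / ϖ⁻ⁿ 𝒪`, the group `K` is normal in `H`, and `I = H / K` is a finite group. The functions
supported on `H` and right invariant under `K` are the functions on `I`, and `𝓓(X_n × X_n)` is the
increasing union over `M` of these spaces (`Tower.IsLevel.of_isBruhat`). The phase
`P(g) = Ψ(φ(a₁) t₂ - φ(a₂) t₁)` is right `K`-invariant on `H` (`phase_mul_small`), so the form of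
`F` restricted to level `M` is that of the matrix `(q^{2n} vol(K) P(j i⁻¹))_{i, j ∈ I}`
(`Tower.integral_convIntegrand`). This matrix is unitary (`convMatrix_mem_unitaryGroup`) as soon as
`∑_j P(j) conj P(j m) = 0` for `m ≠ 1`, which holds for `m = ((d₁, [r₁]), (d₂, [r₂]))` because:

* if `d₁` or `d₂` is not in `U_M`, the sum over `t₁, t₂` is that of a character, and the character
  is nontrivial for all `a₁, a₂` (`sub_one_mem_of_coeff`, `exists_twist_of_not_mem`);
* if `d₁, d₂ ∈ U_M` and, for instance, `r₂ ≠ 0`, a translation of `a₁` by `1 + y` multiplies the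
  summand by a constant `Ψ(-2 y r₂) ≠ 1` (`exists_twist_of_mem`).

Both need that `2` is a unit of `𝒪`. This is what the hypotheses on `k` say: if `2` were nonzero and
not a unit, the completeness of `𝒪` would give a continuous homomorphism `ℚ₂ → k`
(`exists_continuous_ringHom_padic`).

A form on a dense subspace that is unitary on each step of an exhaustion extends to a unique bounded
operator, which is unitary (`exists_unique_unitary_of_form`). The Bruhat space is dense in `L²`
because the cosets of the groups `K` generate the Borel sets (`Tower.denseRange_toL2`).
-/

noncomputable section

namespace FuchsCocycle

/-! ### Forms on a dense subspace that are unitary on each step of an exhaustion -/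

section Hilbert

variable {E D : Type*} [NormedAddCommGroup E] [InnerProductSpace ℂ E] [AddCommGroup D] [Module ℂ D]

/-- If a form `B` on an increasing union of sets `V N` is given on each `V N` by a vector `f'` of
`V N` of the same norm as `f`, then `f'` does not depend on `N`: for `N ≤ M` the projection to the
span of `V N` of the vector found in `V M` already has full norm. -/
theorem exists_vector_of_form (ι : D →ₗ[ℂ] E) (B : D → D → ℂ) (V : ℕ → Set D) (hV : Monotone V)
    (hVD : ∀ f, ∃ N, f ∈ V N)
    (hr : ∀ N, ∀ f ∈ V N, ∃ f' ∈ V N, ‖ι f'‖ = ‖ι f‖ ∧ ∀ h ∈ V N, B h f = inner ℂ (ι h) (ι f'))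
    (f : D) : ∃ t : E, ‖t‖ = ‖ι f‖ ∧ ∀ h, B h f = inner ℂ (ι h) t := by
  obtain ⟨N, hN⟩ := hVD f
  obtain ⟨f₀, hf₀, hn₀, hB₀⟩ := hr N f hN
  refine ⟨ι f₀, hn₀, fun h => ?_⟩
  obtain ⟨M, hM⟩ := hVD h
  obtain ⟨f₁, hf₁, hn₁, hB₁⟩ := hr (max N M) f (hV (le_max_left _ _) hN)
  have h01 : inner ℂ (ι f₀) (ι f₁) = inner ℂ (ι f₀) (ι f₀) := by
    rw [← hB₁ f₀ (hV (le_max_left _ _) hf₀), hB₀ f₀ hf₀]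
  have heq : ι f₁ = ι f₀ := by
    have h2 : ‖ι f₁ - ι f₀‖ ^ 2 = 0 := by
      rw [norm_sub_sq (𝕜 := ℂ), ← inner_conj_symm, h01, inner_self_eq_norm_sq_to_K, hn₀, hn₁]
      simp only [map_pow, RCLike.conj_ofReal]
      norm_cast
      ring
    simpa [sub_eq_zero] using h2
  rw [hB₁ h (hV (le_max_right _ _) hM), heq]

/-- A form on a dense subspace, exhausted by sets on each of which both the form and its adjoint
are given by norm preserving maps, extends to a unique bounded operator, and that is unitary. -/
theorem exists_unique_unitary_of_form [CompleteSpace E] (ι : D →ₗ[ℂ] E) (hι : DenseRange ι)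
    (B : D → D → ℂ) (V : ℕ → Set D) (hV : Monotone V) (hVD : ∀ f, ∃ N, f ∈ V N)
    (hr : ∀ N, ∀ f ∈ V N, ∃ f' ∈ V N, ‖ι f'‖ = ‖ι f‖ ∧ ∀ h ∈ V N, B h f = inner ℂ (ι h) (ι f'))
    (hl : ∀ N, ∀ h ∈ V N, ∃ h' ∈ V N, ‖ι h'‖ = ‖ι h‖ ∧ ∀ f ∈ V N, B h f = inner ℂ (ι h') (ι f)) :
    ∃ T ∈ unitary (E →L[ℂ] E), (∀ h f, inner ℂ (ι h) (T (ι f)) = B h f) ∧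
      ∀ T' : E →L[ℂ] E, (∀ h f, inner ℂ (ι h) (T' (ι f)) = B h f) → T' = T := by
  have ext_left : ∀ x y : E, (∀ h, inner ℂ (ι h) x = inner ℂ (ι h) y) → x = y := by
    intro x y hxy
    refine ext_inner_left ℂ fun v => ?_
    exact congrFun (hι.equalizer (g := fun v => inner ℂ v x) (h := fun v => inner ℂ v y)
      (by fun_prop) (by fun_prop) (funext hxy)) v
  choose t ht hBt using exists_vector_of_form ι B V hV hVD hr
  choose s hs hBs using exists_vector_of_form ι (fun f h => starRingEnd ℂ (B h f)) V hV hVD (by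
    intro N h hh
    obtain ⟨h', hh', hn, hB⟩ := hl N h hh
    exact ⟨h', hh', hn, fun f hf => by rw [hB f hf, inner_conj_symm]⟩)
  have hadd : ∀ f g, t (f + g) = t f + t g := fun f g => ext_left _ _ fun h => by
    apply (starRingEnd ℂ).injective
    have := hBs h (f + g)
    rw [map_add, inner_add_left, ← hBs, ← hBs] at this
    rw [inner_add_right, ← hBt, ← hBt, ← hBt, this, map_add]
  have hsmul : ∀ (c : ℂ) f, t (c • f) = c • t f := fun c f => ext_left _ _ fun h => by
    apply (starRingEnd ℂ).injective
    have := hBs h (c • f)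
    rw [map_smul, inner_smul_left, ← hBs] at this
    rw [inner_smul_right, ← hBt, ← hBt, this, map_mul]
  let T₀ : D →ₗ[ℂ] E := { toFun := t, map_add' := hadd, map_smul' := hsmul }
  have hb : ∀ x, ‖T₀ x‖ ≤ 1 * ‖ι x‖ := fun x => by rw [one_mul]; exact (ht x).le
  let T : E →L[ℂ] E := T₀.extendOfNorm ι
  have hT : ∀ f, T (ι f) = t f := fun f => LinearMap.extendOfNorm_eq hι ⟨1, hb⟩ f
  have hTs : ∀ h, T.adjoint (ι h) = s h := by
    refine fun h => ext_left _ _ fun f => ?_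
    rw [ContinuousLinearMap.adjoint_inner_right, ← hBs, hT, hBt, inner_conj_symm]
  have hnT : ∀ x, ‖T x‖ = ‖x‖ := fun x =>
    congrFun (hι.equalizer (g := fun v => ‖T v‖) (h := fun v => ‖v‖)
      (by fun_prop) (by fun_prop) (funext fun f => by simp [hT, ht])) x
  have hnTs : ∀ x, ‖T.adjoint x‖ = ‖x‖ := fun x =>
    congrFun (hι.equalizer (g := fun v => ‖T.adjoint v‖) (h := fun v => ‖v‖)
      (by fun_prop) (by fun_prop) (funext fun f => by simp [hTs, hs])) x
  refine ⟨T, ?_, fun h f => by rw [hT, hBt], fun T' hT' => ?_⟩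
  · rw [Unitary.mem_iff, ContinuousLinearMap.star_eq_adjoint]
    refine ⟨(ContinuousLinearMap.norm_map_iff_adjoint_comp_self T).mp hnT, ?_⟩
    have := (ContinuousLinearMap.norm_map_iff_adjoint_comp_self T.adjoint).mp hnTs
    rwa [ContinuousLinearMap.adjoint_adjoint] at this
  · refine ContinuousLinearMap.ext fun x => congrFun (hι.equalizer (by fun_prop) (by fun_prop)
      (funext fun f => ext_left _ _ fun h => ?_)) x
    simp only [Function.comp_apply]
    rw [hT', hT, hBt]

end Hilbert

/-! ### Convolution matrices of finite groups -/

section FiniteGroup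

variable {I : Type*} [Group I] [Fintype I]

/-- A sum over a finite group vanishes if on each coset of a subgroup the summand is multiplied by
a constant `≠ 1` under some translation by an element of that subgroup. -/
theorem sum_eq_zero_of_twist (T : Subgroup I) (S : I → ℂ)
    (h : ∀ i, ∃ t ∈ T, ∃ ζ : ℂ, ζ ≠ 1 ∧ ∀ s ∈ T, S (i * s * t) = ζ * S (i * s)) :
    ∑ i, S i = 0 := by
  classical
  have h1 : ∀ i, ∑ s : T, S (i * s) = 0 := by
    intro i
    obtain ⟨t, ht, ζ, hζ, hS⟩ := h i
    have h2 : ∑ s : T, S (i * s) = ζ * ∑ s : T, S (i * s) := by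
      rw [Finset.mul_sum, ← Equiv.sum_comp (Equiv.mulRight (⟨t, ht⟩ : T))]
      refine Finset.sum_congr rfl fun s _ => ?_
      rw [← hS s s.2]
      simp [mul_assoc]
    have h3 : (1 - ζ) * ∑ s : T, S (i * s) = 0 := by linear_combination h2
    exact (mul_eq_zero.mp h3).resolve_left (sub_ne_zero.mpr hζ.symm)
  have h4 : ∑ s : T, ∑ i, S (i * s) = 0 := by
    rw [Finset.sum_comm]
    exact Finset.sum_eq_zero fun i _ => h1 i
  have h5 : ∀ s : T, ∑ i, S (i * s) = ∑ i, S i := fun s =>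
    Equiv.sum_comp (Equiv.mulRight (s : I)) S
  simp only [h5, Finset.sum_const, Finset.card_univ, nsmul_eq_mul] at h4
  exact (mul_eq_zero.mp h4).resolve_left (by exact_mod_cast Fintype.card_ne_zero)

variable [DecidableEq I]

/-- The matrix of the convolution operator `∑ j, a P(j) λ_{j⁻¹}` of a finite group. -/
def convMatrix (a : ℝ) (P : I → ℂ) : Matrix I I ℂ := fun i j => a * P (j * i⁻¹)

theorem convMatrix_mem_unitaryGroup {a : ℝ} {P : I → ℂ} (hP : ∀ i, ‖P i‖ = 1)
    (horth : ∀ m, m ≠ 1 → ∑ j, P j * starRingEnd ℂ (P (j * m)) = 0)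
    (ha : a ^ 2 * Fintype.card I = 1) : convMatrix a P ∈ Matrix.unitaryGroup I ℂ := by
  rw [Matrix.mem_unitaryGroup_iff]
  ext i i'
  rw [Matrix.mul_apply, ← Equiv.sum_comp (Equiv.mulRight i)]
  have h1 : ∀ j, convMatrix a P i (Equiv.mulRight i j) *
      (star (convMatrix a P)) (Equiv.mulRight i j) i' =
      a ^ 2 * (P j * starRingEnd ℂ (P (j * (i * i'⁻¹)))) := by
    intro j
    simp only [convMatrix, Matrix.star_apply, Equiv.coe_mulRight, mul_assoc j, mul_inv_cancel,
      RCLike.star_def, map_mul, Complex.conj_ofReal, mul_one]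
    ring
  rw [Finset.sum_congr rfl fun j _ => h1 j, ← Finset.mul_sum]
  by_cases hi : i = i'
  · subst hi
    simp only [mul_inv_cancel, mul_one, Complex.mul_conj, Complex.normSq_eq_norm_sq, hP,
      Matrix.one_apply_eq]
    simp only [one_pow, Complex.ofReal_one, Finset.sum_const, Finset.card_univ, nsmul_eq_mul,
      mul_one]
    exact_mod_cast ha
  · rw [horth _ (by rwa [Ne, mul_inv_eq_one]), mul_zero, Matrix.one_apply_ne hi]

end FiniteGroup

/-! ### Towers of compact open subgroups and their locally constant functions -/

section Tower

open Topology Pointwise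

variable {G : Type*} [Group G] [TopologicalSpace G] [MeasurableSpace G]

/-- Two sequences of subgroups `H N` (increasing, absorbing the compact sets, of finite measure)
and `K N` (decreasing), with `K N` normal in `H N`, such that the left cosets `x K N` with `x ∈ H N`
form a basis of neighbourhoods of `x` and have a positive measure `c N` independent of `x`. The
topology is only assumed to be given by these cosets; `G` is not required to be a topological
group. -/
structure Tower (ν : Measure G) where
  /-- the increasing sequence of large subgroups -/
  H : ℕ → Subgroup G
  /-- the decreasing sequence of small subgroups -/
  K : ℕ → Subgroup G
  /-- the measure of the cosets of `K N` -/
  c : ℕ → ℝ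
  H_mono : Monotone H
  K_anti : Antitone K
  K_le : ∀ N, K N ≤ H N
  conj_mem : ∀ N, ∀ g ∈ H N, ∀ k ∈ K N, g * k * g⁻¹ ∈ K N
  nhds_basis : ∀ x : G, (𝓝 x).HasBasis (fun N : ℕ => x ∈ H N) fun N => x • (K N : Set G)
  exhaust : ∀ S : Set G, IsCompact S → ∃ N, S ⊆ H N
  c_pos : ∀ N, 0 < c N
  measure_coset : ∀ N, ∀ x ∈ H N, ν (x • (K N : Set G)) = ENNReal.ofReal (c N)
  measure_H : ∀ N, ν (H N) ≠ ⊤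
  isCompact_H : ∀ N, IsCompact (H N : Set G)

namespace Tower

variable {ν : Measure G} (T : Tower ν)

theorem mem_coset {N : ℕ} {x y : G} : y ∈ x • (T.K N : Set G) ↔ x⁻¹ * y ∈ T.K N := by
  rw [Set.mem_smul_set_iff_inv_smul_mem]; rfl

theorem coset_eq {N : ℕ} {x y : G} (h : y ∈ x • (T.K N : Set G)) :
    y • (T.K N : Set G) = x • (T.K N : Set G) := by
  rw [mem_coset] at h
  ext z
  rw [mem_coset, mem_coset, show x⁻¹ * z = (x⁻¹ * y) * (y⁻¹ * z) by group,
    (T.K N).mul_mem_cancel_left h]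

theorem self_mem_coset (N : ℕ) (x : G) : x ∈ x • (T.K N : Set G) := by simp [mem_coset]

theorem coset_subset_H {N : ℕ} {x : G} (hx : x ∈ T.H N) : x • (T.K N : Set G) ⊆ T.H N := by
  intro y hy
  have := (T.H N).mul_mem hx (T.K_le N (T.mem_coset.mp hy))
  simpa using this

theorem isOpen_coset {N : ℕ} {x : G} (hx : x ∈ T.H N) : IsOpen (x • (T.K N : Set G)) := by
  rw [isOpen_iff_mem_nhds]
  intro y hy
  rw [← T.coset_eq hy]
  exact (T.nhds_basis y).mem_of_mem (T.coset_subset_H hx hy)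

theorem isOpen_H (N : ℕ) : IsOpen (T.H N : Set G) := by
  rw [isOpen_iff_mem_nhds]
  intro y hy
  exact Filter.mem_of_superset ((T.nhds_basis y).mem_of_mem (i := N) hy) (T.coset_subset_H hy)

/-- The finite group `H N / K N`, realised with `K N` as a subgroup of `H N`. -/
abbrev Quot (N : ℕ) : Type _ := T.H N ⧸ (T.K N).subgroupOf (T.H N)

instance normal (N : ℕ) : ((T.K N).subgroupOf (T.H N)).Normal where
  conj_mem k hk g := by
    rw [Subgroup.mem_subgroupOf] at hk ⊢
    exact T.conj_mem N g g.2 k hk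

/-- The class in `H N / K N` of an element of `H N`. -/
abbrev cls {N : ℕ} (x : T.H N) : T.Quot N := QuotientGroup.mk x

theorem cls_eq_iff {N : ℕ} {x y : T.H N} :
    T.cls x = T.cls y ↔ (y : G) ∈ (x : G) • (T.K N : Set G) := by
  rw [QuotientGroup.eq, Subgroup.mem_subgroupOf, mem_coset]; rfl

/-- A chosen representative in `G` of a class in `H N / K N`. -/
def rep {N : ℕ} (i : T.Quot N) : G := (Quotient.out i : T.H N)

theorem rep_mem {N : ℕ} (i : T.Quot N) : T.rep i ∈ T.H N := (Quotient.out i : T.H N).2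

theorem cls_rep {N : ℕ} (i : T.Quot N) : T.cls ⟨T.rep i, T.rep_mem i⟩ = i :=
  QuotientGroup.out_eq' i

theorem mem_rep_coset {N : ℕ} {i : T.Quot N} {x : T.H N} :
    (x : G) ∈ T.rep i • (T.K N : Set G) ↔ T.cls x = i := by
  have := T.cls_eq_iff (x := ⟨T.rep i, T.rep_mem i⟩) (y := x)
  rw [T.cls_rep] at this
  rw [← this, eq_comm]

/-- The functions supported on `H N` and invariant under `K N` from the right. -/
structure IsLevel (N : ℕ) (f : G → ℂ) : Prop where
  support : ∀ x, f x ≠ 0 → x ∈ T.H N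
  invariant : ∀ x, ∀ k ∈ T.K N, f (x * k) = f x

variable {T}

namespace IsLevel

variable {N M : ℕ} {f h : G → ℂ}

theorem of_ne (hs : ∀ x, x ∉ T.H N → f x = 0) (hi : ∀ x ∈ T.H N, ∀ k ∈ T.K N, f (x * k) = f x) :
    T.IsLevel N f where
  support x hx := by
    by_contra h
    exact hx (hs x h)
  invariant x k hk := by
    by_cases hx : x ∈ T.H N
    · exact hi x hx k hk
    · rw [hs x hx, hs]
      rwa [(T.H N).mul_mem_cancel_right (T.K_le N hk)]

theorem eq_zero (hf : T.IsLevel N f) {x : G} (hx : x ∉ T.H N) : f x = 0 := by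
  by_contra h
  exact hx (hf.support x h)

theorem mono (hf : T.IsLevel N f) (h : N ≤ M) : T.IsLevel M f :=
  ⟨fun x hx => T.H_mono h (hf.support x hx), fun x k hk => hf.invariant x k (T.K_anti h hk)⟩

theorem eq_of_mem (hf : T.IsLevel N f) {x y : G} (h : y ∈ x • (T.K N : Set G)) : f y = f x := by
  rw [T.mem_coset] at h
  simpa using hf.invariant x _ h

theorem apply_rep (hf : T.IsLevel N f) (x : T.H N) : f (T.rep (T.cls x)) = f x := by
  refine (hf.eq_of_mem (x := T.rep (T.cls x)) ?_).symm
  rw [T.mem_rep_coset]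

/-- Functions of level `N` are locally constant and compactly supported. -/
theorem isBruhat [R1Space G] (hf : T.IsLevel N f) : IsBruhat f := by
  refine ⟨(IsLocallyConstant.iff_exists_open f).mpr fun x => ?_, ?_⟩
  · obtain ⟨M, hM⟩ := T.exhaust {x} isCompact_singleton
    exact ⟨_, T.isOpen_coset (T.H_mono (le_max_right N M) (hM rfl)), T.self_mem_coset _ x,
      fun y hy => (hf.mono (le_max_left N M)).eq_of_mem hy⟩
  · exact HasCompactSupport.intro (T.isCompact_H N) fun x hx => hf.eq_zero hx

end IsLevel

theorem IsLevel.of_isBruhat {f : G → ℂ} (hf : IsBruhat f) : ∃ N, T.IsLevel N f := by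
  obtain ⟨hl, hc⟩ := hf
  obtain ⟨N₀, hN₀⟩ := T.exhaust _ hc
  have h1 : ∀ x, ∃ N, x ∈ T.H N ∧ ∀ y ∈ x • (T.K N : Set G), f y = f x := by
    intro x
    obtain ⟨N, hx, hN⟩ := (T.nhds_basis x).mem_iff.mp ((hl.isOpen_fiber (f x)).mem_nhds rfl)
    exact ⟨N, hx, fun y hy => hN hy⟩
  choose m hmH hm using h1
  obtain ⟨t, ht⟩ := hc.elim_finite_subcover (fun x => x • (T.K (m x) : Set G))
    (fun x => T.isOpen_coset (hmH x)) fun x _ => Set.mem_iUnion.mpr ⟨x, T.self_mem_coset _ x⟩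
  have h2 : ∀ x ∈ tsupport f, ∀ k ∈ T.K (t.sup m), f (x * k) = f x := by
    intro x hx k hk
    obtain ⟨y, hy, hxy⟩ := Set.mem_iUnion₂.mp (ht hx)
    rw [hm y x hxy, hm y]
    rw [T.mem_coset] at hxy ⊢
    rw [← mul_assoc]
    exact (T.K (m y)).mul_mem hxy (T.K_anti (Finset.le_sup hy) hk)
  refine ⟨max N₀ (t.sup m), fun x hx => T.H_mono (le_max_left _ _) (hN₀ (subset_tsupport f hx)),
    fun x k hk => ?_⟩
  replace hk := T.K_anti (le_max_right N₀ (t.sup m)) hk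
  by_cases hx : x ∈ tsupport f
  · exact h2 x hx k hk
  by_cases hxk : x * k ∈ tsupport f
  · have := h2 _ hxk _ ((T.K _).inv_mem hk)
    rw [mul_inv_cancel_right] at this
    exact this.symm
  · rw [image_eq_zero_of_notMem_tsupport hx, image_eq_zero_of_notMem_tsupport hxk]

variable (T)

theorem measureReal_coset {N : ℕ} {x : G} (hx : x ∈ T.H N) :
    ν.real (x • (T.K N : Set G)) = T.c N := by
  rw [Measure.real, T.measure_coset N x hx, ENNReal.toReal_ofReal (T.c_pos N).le]

theorem iUnion_rep (N : ℕ) : ⋃ i : T.Quot N, T.rep i • (T.K N : Set G) = T.H N := by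
  refine Set.Subset.antisymm (Set.iUnion_subset fun i => T.coset_subset_H (T.rep_mem i)) ?_
  exact fun x hx => Set.mem_iUnion.mpr ⟨T.cls ⟨x, hx⟩, (T.mem_rep_coset (x := ⟨x, hx⟩)).mpr rfl⟩

theorem disjoint_rep (N : ℕ) :
    Pairwise (Function.onFun Disjoint fun i : T.Quot N => T.rep i • (T.K N : Set G)) := by
  intro i j hij
  refine Set.disjoint_left.mpr fun x hx hx' => hij ?_
  have hH := T.coset_subset_H (T.rep_mem i) hx
  rw [← (T.mem_rep_coset (x := ⟨x, hH⟩)).mp hx, ← (T.mem_rep_coset (x := ⟨x, hH⟩)).mp hx']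

section Measure

variable [BorelSpace G]

theorem measurableSet_coset {N : ℕ} {x : G} (hx : x ∈ T.H N) :
    MeasurableSet (x • (T.K N : Set G)) :=
  (T.isOpen_coset hx).measurableSet

instance finite_quot (N : ℕ) : Finite (T.Quot N) := by
  have h := Measure.finite_const_le_meas_of_disjoint_iUnion ν
    (ε := ENNReal.ofReal (T.c N)) (by simpa using T.c_pos N)
    (As := fun i : T.Quot N => T.rep i • (T.K N : Set G))
    (fun i => T.measurableSet_coset (T.rep_mem i)) (T.disjoint_rep N)
    (by rw [iUnion_rep]; exact T.measure_H N)
  simp only [T.measure_coset N _ (T.rep_mem _), le_refl, Set.ofPred_true] at h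
  exact Set.finite_univ_iff.mp h

instance fintypeQuot (N : ℕ) : Fintype (T.Quot N) := Fintype.ofFinite _

variable {T}

theorem IsLevel.eq_sum {N : ℕ} {f : G → ℂ} (hf : T.IsLevel N f) :
    f = fun x => ∑ i : T.Quot N,
      (T.rep i • (T.K N : Set G)).indicator (fun _ => f (T.rep i)) x := by
  classical
  funext x
  by_cases hx : x ∈ T.H N
  · have : ∀ i : T.Quot N, (T.rep i • (T.K N : Set G)).indicator (fun _ => f (T.rep i)) x =
        if T.cls ⟨x, hx⟩ = i then f x else 0 := by
      intro i
      rw [Set.indicator_apply]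
      have h1 := T.mem_rep_coset (i := i) (x := ⟨x, hx⟩)
      split_ifs with h2 h3 h3
      · rw [← hf.eq_of_mem h2]
      · exact absurd (h1.mp h2) h3
      · exact absurd (h1.mpr h3) h2
      · rfl
    simp [this]
  · rw [hf.eq_zero hx, Finset.sum_eq_zero]
    intro i _
    rw [Set.indicator_of_notMem]
    exact fun h => hx (T.coset_subset_H (T.rep_mem i) h)

theorem integrable_indicator_coset {N : ℕ} {x : G} (hx : x ∈ T.H N) (z : ℂ) :
    Integrable ((x • (T.K N : Set G)).indicator fun _ => z) ν :=
  (integrable_indicator_iff (T.measurableSet_coset hx)).mpr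
    (integrableOn_const (by rw [T.measure_coset N x hx]; exact ENNReal.ofReal_ne_top))

theorem IsLevel.integrable {N : ℕ} {f : G → ℂ} (hf : T.IsLevel N f) : Integrable f ν := by
  rw [hf.eq_sum]
  exact integrable_finsetSum _ fun i _ => integrable_indicator_coset (T.rep_mem i) _

theorem IsLevel.integral_eq {N : ℕ} {f : G → ℂ} (hf : T.IsLevel N f) :
    ∫ x, f x ∂ν = T.c N * ∑ i : T.Quot N, f (T.rep i) := by
  conv_lhs => rw [hf.eq_sum]
  rw [integral_finsetSum _ fun i _ => integrable_indicator_coset (T.rep_mem i) _, Finset.mul_sum]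
  refine Finset.sum_congr rfl fun i _ => ?_
  rw [integral_indicator_const _ (T.measurableSet_coset (T.rep_mem i)),
    T.measureReal_coset (T.rep_mem i)]
  simp

theorem IsLevel.memLp {N : ℕ} {f : G → ℂ} (hf : T.IsLevel N f) : MemLp f 2 ν := by
  rw [hf.eq_sum]
  refine memLp_finsetSum _ fun i _ =>
    memLp_indicator_const 2 (T.measurableSet_coset (T.rep_mem i)) _ ?_
  exact Or.inr (by rw [T.measure_coset N _ (T.rep_mem i)]; exact ENNReal.ofReal_ne_top)

variable (T)

/-- The order of `H N / K N` is the quotient of the measures of `H N` and of a coset of `K N`. -/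
theorem c_mul_card (N : ℕ) : T.c N * Fintype.card (T.Quot N) = ν.real (T.H N) := by
  rw [← T.iUnion_rep, measureReal_iUnion_fintype (T.disjoint_rep N)
    (fun i => T.measurableSet_coset (T.rep_mem i))
    (fun i => by rw [T.measure_coset N _ (T.rep_mem i)]; exact ENNReal.ofReal_ne_top)]
  simp only [T.measureReal_coset (T.rep_mem _), Finset.sum_const, Finset.card_univ, nsmul_eq_mul]
  ring

end Measure

end Tower

end Tower

/-! ### Density of the Bruhat space -/

/-- The Bruhat space `𝓓(Y)` as a space of functions. -/
def bruhatSpace (Y : Type*) [TopologicalSpace Y] : Submodule ℂ (Y → ℂ) where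
  carrier := {f | IsBruhat f}
  zero_mem' := ⟨IsLocallyConstant.const 0, HasCompactSupport.zero⟩
  add_mem' hf hg := ⟨hf.1.add hg.1, hf.2.add hg.2⟩
  smul_mem' c _ hf := ⟨hf.1.comp (c • ·), hf.2.comp_left (g := (c • ·)) (smul_zero c)⟩

namespace Tower

open Topology Pointwise

variable {G : Type*} [Group G] [TopologicalSpace G] [MeasurableSpace G] {ν : Measure G}
  (T : Tower ν)

theorem K_le_H (M N : ℕ) : T.K M ≤ T.H N := by
  rcases le_total M N with h | h
  · exact (T.K_le M).trans (T.H_mono h)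
  · exact (T.K_anti h).trans (T.K_le N)

theorem iUnion_H : ⋃ N, (T.H N : Set G) = Set.univ := by
  refine Set.eq_univ_of_forall fun x => ?_
  obtain ⟨N, hN⟩ := T.exhaust {x} isCompact_singleton
  exact Set.mem_iUnion.mpr ⟨N, hN rfl⟩

theorem isLevel_indicator_coset {N : ℕ} {x : G} (hx : x ∈ T.H N) :
    T.IsLevel N ((x • (T.K N : Set G)).indicator 1) := by
  refine ⟨fun y hy => T.coset_subset_H hx (Set.mem_of_indicator_ne_zero hy), fun y k hk => ?_⟩
  have : y * k ∈ x • (T.K N : Set G) ↔ y ∈ x • (T.K N : Set G) := by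
    rw [T.mem_coset, T.mem_coset, ← mul_assoc, (T.K N).mul_mem_cancel_right hk]
  by_cases hy : y ∈ x • (T.K N : Set G) <;> simp [hy, this]

theorem isLevel_indicator_H (N : ℕ) : T.IsLevel N ((T.H N : Set G).indicator 1) := by
  refine ⟨fun y hy => Set.mem_of_indicator_ne_zero hy, fun y k hk => ?_⟩
  have : y * k ∈ (T.H N : Set G) ↔ y ∈ (T.H N : Set G) :=
    (T.H N).mul_mem_cancel_right (T.K_le N hk)
  by_cases hy : y ∈ (T.H N : Set G) <;> simp only [hy, this, Set.indicator_of_mem,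
    Set.indicator_of_notMem, Pi.one_apply, not_false_eq_true]

/-- The cosets `x K N` form a `π`-system, since two of them that meet are nested. -/
theorem isPiSystem_coset : IsPiSystem {s : Set G | ∃ N, ∃ x ∈ T.H N, s = x • (T.K N : Set G)} := by
  rintro _ ⟨N, x, hx, rfl⟩ _ ⟨M, y, hy, rfl⟩ ⟨z, hz, hz'⟩
  refine ⟨max N M, z, T.H_mono (le_max_left N M) (T.coset_subset_H hx hz), ?_⟩
  rw [← T.coset_eq hz, ← T.coset_eq hz']
  ext w
  simp only [Set.mem_inter_iff, T.mem_coset]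
  constructor
  · intro h
    rcases le_total N M with h' | h'
    · rw [max_eq_right h']; exact h.2
    · rw [max_eq_left h']; exact h.1
  · exact fun h => ⟨T.K_anti (le_max_left _ _) h, T.K_anti (le_max_right _ _) h⟩

variable [BorelSpace G]

theorem memLp_of_isBruhat (T : Tower ν) {f : G → ℂ} (hf : IsBruhat f) : MemLp f 2 ν := by
  obtain ⟨N, hN⟩ := IsLevel.of_isBruhat (T := T) hf
  exact hN.memLp

/-- The map from the Bruhat space to `L²`. -/
def toL2 : bruhatSpace G →ₗ[ℂ] Lp ℂ 2 ν where
  toFun f := (T.memLp_of_isBruhat f.2).toLp f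
  map_add' _ _ := MemLp.toLp_add _ _
  map_smul' _ _ := MemLp.toLp_const_smul _ _

theorem toL2_ae_eq (f : bruhatSpace G) : T.toL2 f =ᵐ[ν] f :=
  MemLp.coeFn_toLp (T.memLp_of_isBruhat f.2)

theorem inner_toL2 (f : bruhatSpace G) (g : Lp ℂ 2 ν) :
    inner ℂ (T.toL2 f) g = ∫ x, starRingEnd ℂ ((f : G → ℂ) x) * g x ∂ν := by
  rw [L2.inner_def]
  refine integral_congr_ae ?_
  filter_upwards [T.toL2_ae_eq f] with x hx
  rw [hx, RCLike.inner_apply, mul_comm]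

theorem eq_generateFrom_coset [SecondCountableTopology G] :
    ‹MeasurableSpace G› =
      MeasurableSpace.generateFrom {s : Set G | ∃ N, ∃ x ∈ T.H N, s = x • (T.K N : Set G)} := by
  refine (BorelSpace.measurable_eq (α := G)).trans ?_
  refine TopologicalSpace.IsTopologicalBasis.borel_eq_generateFrom ?_
  refine TopologicalSpace.isTopologicalBasis_of_isOpen_of_nhds ?_ fun x u hx hu => ?_
  · rintro _ ⟨N, x, hx, rfl⟩
    exact T.isOpen_coset hx
  · obtain ⟨N, hxN, hN⟩ := (T.nhds_basis x).mem_iff.mp (hu.mem_nhds hx)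
    exact ⟨_, ⟨N, x, hxN, rfl⟩, T.self_mem_coset N x, hN⟩

/-- A function in `L²` orthogonal to the Bruhat space has integral `0` over each coset, hence over
each Borel subset of `H N`. -/
theorem denseRange_toL2 [R1Space G] [SecondCountableTopology G] : DenseRange T.toL2 := by
  have hr : Set.range T.toL2 = (LinearMap.range T.toL2 : Set (Lp ℂ 2 ν)) := rfl
  rw [DenseRange, hr, Submodule.dense_iff_topologicalClosure_eq_top,
    Submodule.topologicalClosure_eq_top_iff, Submodule.eq_bot_iff]
  intro g hg
  have h0 : ∀ {N} {s : Set G}, MeasurableSet s → T.IsLevel N (s.indicator 1) →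
      ∫ x in s, g x ∂ν = 0 := by
    intro N s hs hl
    have h1 := (Submodule.mem_orthogonal _ _).mp hg (T.toL2 ⟨_, hl.isBruhat⟩) ⟨_, rfl⟩
    rw [inner_toL2] at h1
    rw [← h1, ← integral_indicator hs]
    refine integral_congr_ae (Filter.Eventually.of_forall fun x => ?_)
    by_cases hx : x ∈ s <;> simp [hx]
  have hint : ∀ N, Integrable g (ν.restrict (T.H N)) := by
    intro N
    have : IsFiniteMeasure (ν.restrict (T.H N : Set G)) :=
      ⟨by rw [Measure.restrict_apply_univ]; exact (T.measure_H N).lt_top⟩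
    exact ((Lp.memLp g).restrict _).integrable (by norm_num)
  have hset : ∀ N, ∀ s, MeasurableSet s → ∫ x in s, g x ∂(ν.restrict (T.H N)) = 0 := by
    intro N s hs
    have huniv : ∫ x, g x ∂(ν.restrict (T.H N)) = 0 :=
      h0 (T.isOpen_H N).measurableSet (T.isLevel_indicator_H N)
    induction s, hs using MeasurableSpace.induction_on_inter T.eq_generateFrom_coset
      T.isPiSystem_coset with
    | empty => simp
    | basic t ht =>
      obtain ⟨M, x, hxM, rfl⟩ := ht
      rw [Measure.restrict_restrict (T.measurableSet_coset hxM)]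
      by_cases hx : x ∈ T.H N
      · have : x • (T.K M : Set G) ⊆ T.H N := fun y hy => by
          have := (T.H N).mul_mem hx (T.K_le_H M N (T.mem_coset.mp hy))
          simpa using this
        rw [Set.inter_eq_left.mpr this]
        exact h0 (T.measurableSet_coset hxM) (T.isLevel_indicator_coset hxM)
      · have : x • (T.K M : Set G) ∩ T.H N = ∅ := by
          refine Set.eq_empty_of_forall_notMem fun y hy => hx ?_
          have := (T.H N).mul_mem hy.2 ((T.H N).inv_mem (T.K_le_H M N (T.mem_coset.mp hy.1)))
          simpa using this
        rw [this]
        simp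
    | compl t ht h =>
      have := integral_add_compl ht (hint N)
      rwa [h, huniv, zero_add] at this
    | iUnion f hd hf h =>
      rw [integral_iUnion hf hd (hint N).integrableOn]
      simp [h]
  have hae : ∀ N, ∀ᵐ x ∂(ν.restrict (T.H N)), g x = 0 := fun N =>
    (hint N).ae_eq_zero_of_forall_setIntegral_eq_zero fun s hs _ => hset N s hs
  rw [Lp.eq_zero_iff_ae_eq_zero]
  have := (ae_restrict_iUnion_iff (μ := ν) (fun N => (T.H N : Set G)) fun x => g x = 0).mpr hae
  rwa [T.iUnion_H, Measure.restrict_univ] at this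

end Tower

/-! ### Convolution forms on a tower -/

namespace Tower

open Topology Pointwise

variable {G : Type*} [Group G] [TopologicalSpace G] [MeasurableSpace G] {ν : Measure G}

/-- The integrand of the form of the convolution operator `∫ P(g) λ_{g⁻¹} d[g]`. -/
def convIntegrand (ν : Measure G) (P : G → ℂ) (h f : G → ℂ) (g : G) : ℂ :=
  P g * ∫ x, starRingEnd ℂ (h x) * f (g * x) ∂ν

variable (T : Tower ν)

open Classical in
/-- The function of level `N` with given values on the classes of `H N / K N`. -/
def lift {N : ℕ} (v : T.Quot N → ℂ) (x : G) : ℂ :=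
  if hx : x ∈ T.H N then v (T.cls ⟨x, hx⟩) else 0

theorem lift_rep {N : ℕ} (v : T.Quot N → ℂ) (i : T.Quot N) : T.lift v (T.rep i) = v i := by
  rw [lift, dif_pos (T.rep_mem i), T.cls_rep]

theorem isLevel_lift {N : ℕ} (v : T.Quot N → ℂ) : T.IsLevel N (T.lift v) := by
  refine IsLevel.of_ne (fun x hx => dif_neg hx) fun x hx k hk => ?_
  have hxk := (T.H N).mul_mem hx (T.K_le N hk)
  rw [lift, lift, dif_pos hx, dif_pos hxk]
  congr 1
  refine (T.cls_eq_iff.mpr ?_).symm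
  rw [T.mem_coset]
  simpa using hk

variable {T}

theorem IsLevel.apply_rep_mul {N : ℕ} {f : G → ℂ} (hf : T.IsLevel N f) (i j : T.Quot N) :
    f (T.rep i * T.rep j) = f (T.rep (i * j)) := by
  rw [← hf.apply_rep ⟨T.rep i * T.rep j, (T.H N).mul_mem (T.rep_mem i) (T.rep_mem j)⟩]
  congr 2
  conv_rhs => rw [← T.cls_rep i, ← T.cls_rep j]
  rfl

theorem IsLevel.conj_mul_translate {N : ℕ} {h f : G → ℂ} (hh : T.IsLevel N h)
    (hf : T.IsLevel N f) (g : G) : T.IsLevel N fun x => starRingEnd ℂ (h x) * f (g * x) :=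
  ⟨fun x hx => hh.support x fun h0 => hx (by simp [h0]),
    fun x k hk => by rw [hh.invariant x k hk, ← mul_assoc, hf.invariant _ k hk]⟩

theorem isLevel_convIntegrand {N : ℕ} {P h f : G → ℂ}
    (hP : ∀ g ∈ T.H N, ∀ k ∈ T.K N, P (g * k) = P g) (hh : T.IsLevel N h) (hf : T.IsLevel N f) :
    T.IsLevel N (convIntegrand ν P h f) := by
  refine IsLevel.of_ne (fun g hg => ?_) fun g hg k hk => ?_
  · have : ∀ x, starRingEnd ℂ (h x) * f (g * x) = 0 := by
      intro x
      by_cases hx : x ∈ T.H N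
      · rw [hf.eq_zero (x := g * x), mul_zero]
        rwa [(T.H N).mul_mem_cancel_right hx]
      · rw [hh.eq_zero hx, map_zero, zero_mul]
    simp [convIntegrand, this]
  · rw [convIntegrand, convIntegrand, hP g hg k hk]
    congr 2
    funext x
    by_cases hx : x ∈ T.H N
    · -- `k` is moved to the right of `x` by conjugation with `x⁻¹ ∈ H N`
      have h1 := T.conj_mem N x⁻¹ ((T.H N).inv_mem hx) k hk
      rw [show g * k * x = g * x * (x⁻¹ * k * x⁻¹⁻¹) by group, hf.invariant _ _ h1]
    · rw [hh.eq_zero hx, map_zero, zero_mul, zero_mul]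

variable [BorelSpace G]

open Classical in
/-- On functions of level `N` the convolution form is the form of a convolution matrix of the
finite group `H N / K N`, multiplied by the measure of the cosets of `K N`. -/
theorem integral_convIntegrand {N : ℕ} {P h f : G → ℂ} (A : ℝ)
    (hP : ∀ g ∈ T.H N, ∀ k ∈ T.K N, P (g * k) = P g) (hh : T.IsLevel N h) (hf : T.IsLevel N f) :
    A * ∫ g, convIntegrand ν P h f g ∂ν =
      T.c N * (star (fun i : T.Quot N => h (T.rep i)) ⬝ᵥ
        (convMatrix (A * T.c N) (fun i : T.Quot N => P (T.rep i))).mulVec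
          fun i => f (T.rep i)) := by
  rw [(isLevel_convIntegrand hP hh hf).integral_eq]
  simp only [convIntegrand, (hh.conj_mul_translate hf _).integral_eq, hf.apply_rep_mul,
    dotProduct, Matrix.mulVec, convMatrix, Finset.mul_sum, Pi.star_apply, RCLike.star_def]
  rw [Finset.sum_comm]
  refine Finset.sum_congr rfl fun i _ => ?_
  rw [← Equiv.sum_comp (Equiv.mulRight i⁻¹)]
  refine Finset.sum_congr rfl fun j _ => ?_
  simp only [Equiv.coe_mulRight, inv_mul_cancel_right]
  push_cast
  ring

theorem inner_toL2_level {N : ℕ} {h f : bruhatSpace G} (hh : T.IsLevel N h)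
    (hf : T.IsLevel N f) : inner ℂ (T.toL2 h) (T.toL2 f) =
      T.c N * (star (fun i : T.Quot N => (h : G → ℂ) (T.rep i)) ⬝ᵥ
        fun i => (f : G → ℂ) (T.rep i)) := by
  have h1 := hh.conj_mul_translate hf 1
  rw [inner_toL2]
  have h2 : ∫ x, starRingEnd ℂ ((h : G → ℂ) x) * T.toL2 f x ∂ν =
      ∫ x, starRingEnd ℂ ((h : G → ℂ) x) * (f : G → ℂ) (1 * x) ∂ν := by
    refine integral_congr_ae ?_
    filter_upwards [T.toL2_ae_eq f] with x hx
    rw [hx, one_mul]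
  rw [h2, h1.integral_eq]
  simp [dotProduct]

theorem norm_toL2_eq {N : ℕ} {h f : bruhatSpace G} (hh : T.IsLevel N h) (hf : T.IsLevel N f)
    (heq : star (fun i : T.Quot N => (h : G → ℂ) (T.rep i)) ⬝ᵥ
        (fun i => (h : G → ℂ) (T.rep i)) =
      star (fun i : T.Quot N => (f : G → ℂ) (T.rep i)) ⬝ᵥ fun i => (f : G → ℂ) (T.rep i)) :
    ‖T.toL2 h‖ = ‖T.toL2 f‖ := by
  have h1 : inner ℂ (T.toL2 h) (T.toL2 h) = inner ℂ (T.toL2 f) (T.toL2 f) := by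
    rw [inner_toL2_level hh hh, inner_toL2_level hf hf, heq]
  rw [inner_self_eq_norm_sq_to_K, inner_self_eq_norm_sq_to_K] at h1
  norm_cast at h1
  exact (sq_eq_sq₀ (norm_nonneg _) (norm_nonneg _)).mp h1

variable (T)

open Classical in
/-- The convolution matrix of level `N` is unitary if, for each nontrivial class `m`, the products
`P(g) conj P(g m)` are twisted by constants `≠ 1` under translations from a subgroup `L`. -/
theorem convMatrix_mem_unitaryGroup {N : ℕ} {P : G → ℂ} {A : ℝ} (hP1 : ∀ g, ‖P g‖ = 1)
    (hP : ∀ g ∈ T.H N, ∀ k ∈ T.K N, P (g * k) = P g)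
    (htw : ∀ m ∈ T.H N, m ∉ T.K N → ∃ L ≤ T.H N, ∀ g ∈ T.H N, ∃ t ∈ L, ∃ ζ : ℂ, ζ ≠ 1 ∧
      ∀ s ∈ L, P (g * s * t) * starRingEnd ℂ (P (g * s * t * m)) =
        ζ * (P (g * s) * starRingEnd ℂ (P (g * s * m))))
    (hA : A ^ 2 * T.c N * ν.real (T.H N) = 1) :
    convMatrix (A * T.c N) (fun i : T.Quot N => P (T.rep i)) ∈
      Matrix.unitaryGroup (T.Quot N) ℂ := by
  refine FuchsCocycle.convMatrix_mem_unitaryGroup (fun i => hP1 _) (fun m hm => ?_) ?_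
  · have hPrep : ∀ x : T.H N, P (T.rep (T.cls x)) = P x := by
      intro x
      have h1 := (T.mem_rep_coset (i := T.cls x) (x := x)).mpr rfl
      rw [T.mem_coset] at h1
      rw [← hP _ (T.rep_mem _) _ h1, mul_inv_cancel_left]
    have hmK : T.rep m ∉ T.K N := by
      intro h
      apply hm
      rw [← T.cls_rep m]
      exact (QuotientGroup.eq_one_iff _).mpr h
    obtain ⟨L, hL, htw⟩ := htw _ (T.rep_mem m) hmK
    refine sum_eq_zero_of_twist ((L.subgroupOf (T.H N)).map (QuotientGroup.mk' _)) _ fun i => ?_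
    obtain ⟨t, ht, ζ, hζ, hs⟩ := htw _ (T.rep_mem i)
    refine ⟨T.cls ⟨t, hL ht⟩, ⟨⟨t, hL ht⟩, ht, rfl⟩, ζ, hζ, ?_⟩
    rintro _ ⟨s, hsL, rfl⟩
    have e1 : i * (QuotientGroup.mk' _ s : T.Quot N) * T.cls ⟨t, hL ht⟩ =
        T.cls (⟨T.rep i, T.rep_mem i⟩ * s * ⟨t, hL ht⟩) := by
      conv_lhs => rw [← T.cls_rep i]
      rfl
    have e2 : i * (QuotientGroup.mk' _ s : T.Quot N) =
        T.cls (⟨T.rep i, T.rep_mem i⟩ * s) := by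
      conv_lhs => rw [← T.cls_rep i]
      rfl
    have e3 : ∀ x : T.H N, T.cls x * m = T.cls (x * ⟨T.rep m, T.rep_mem m⟩) := by
      intro x
      conv_lhs => rw [← T.cls_rep m]
      rfl
    rw [e1, e2, e3, e3, hPrep, hPrep, hPrep, hPrep]
    exact hs s hsL
  · rw [← T.c_mul_card] at hA
    linear_combination hA

/-- A convolution form whose matrices are unitary extends to a unique bounded operator of `L²`,
and that is unitary. -/
theorem exists_unique_unitary_of_convIntegrand [R1Space G] [SecondCountableTopology G] {P : G → ℂ}
    {A : ℝ} (hP1 : ∀ g, ‖P g‖ = 1)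
    (hP : ∀ N, ∀ g ∈ T.H N, ∀ k ∈ T.K N, P (g * k) = P g)
    (htw : ∀ N, ∀ m ∈ T.H N, m ∉ T.K N → ∃ L ≤ T.H N, ∀ g ∈ T.H N, ∃ t ∈ L, ∃ ζ : ℂ, ζ ≠ 1 ∧
      ∀ s ∈ L, P (g * s * t) * starRingEnd ℂ (P (g * s * t * m)) =
        ζ * (P (g * s) * starRingEnd ℂ (P (g * s * m))))
    (hA : ∀ N, A ^ 2 * T.c N * ν.real (T.H N) = 1) :
    ∃ F ∈ unitary (Lp ℂ 2 ν →L[ℂ] Lp ℂ 2 ν),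
      (∀ h f : bruhatSpace G,
        inner ℂ (T.toL2 h) (F (T.toL2 f)) = A * ∫ g, convIntegrand ν P h f g ∂ν) ∧
      ∀ F' : Lp ℂ 2 ν →L[ℂ] Lp ℂ 2 ν, (∀ h f : bruhatSpace G,
        inner ℂ (T.toL2 h) (F' (T.toL2 f)) = A * ∫ g, convIntegrand ν P h f g ∂ν) → F' = F := by
  classical
  let b : ∀ {N : ℕ}, (T.Quot N → ℂ) → bruhatSpace G :=
    fun v => ⟨T.lift v, (T.isLevel_lift v).isBruhat⟩
  have hb : ∀ {N : ℕ} (v : T.Quot N → ℂ), (fun i => (b v : G → ℂ) (T.rep i)) = v :=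
    fun v => funext fun i => T.lift_rep v i
  have hM := fun N => T.convMatrix_mem_unitaryGroup hP1 (hP N) (htw N) (hA N)
  refine exists_unique_unitary_of_form T.toL2 T.denseRange_toL2
    (fun h f => A * ∫ g, convIntegrand ν P h f g ∂ν)
    (fun N => {f | T.IsLevel N f}) (fun N M hNM f hf => hf.mono hNM)
    (fun f => IsLevel.of_isBruhat f.2) (fun N f hf => ?_) (fun N h hh => ?_)
  · refine ⟨b ((convMatrix (A * T.c N) (fun i : T.Quot N => P (T.rep i))).mulVec
      fun i => (f : G → ℂ) (T.rep i)), T.isLevel_lift _,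
      norm_toL2_eq (T.isLevel_lift _) hf ?_, fun h hh => ?_⟩
    · rw [hb, Matrix.star_mulVec, ← Matrix.dotProduct_mulVec, Matrix.mulVec_mulVec,
        ← Matrix.star_eq_conjTranspose, Matrix.mem_unitaryGroup_iff'.mp (hM N), Matrix.one_mulVec]
    · rw [inner_toL2_level hh (T.isLevel_lift _), hb, integral_convIntegrand A (hP N) hh hf]
  · refine ⟨b ((star (convMatrix (A * T.c N) (fun i : T.Quot N => P (T.rep i)))).mulVec
      fun i => (h : G → ℂ) (T.rep i)), T.isLevel_lift _,
      norm_toL2_eq (T.isLevel_lift _) hh ?_, fun f hf => ?_⟩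
    · rw [hb, Matrix.star_mulVec, ← Matrix.dotProduct_mulVec, Matrix.mulVec_mulVec,
        ← Matrix.star_eq_conjTranspose, star_star, Matrix.mem_unitaryGroup_iff.mp (hM N),
        Matrix.one_mulVec]
    · rw [inner_toL2_level (T.isLevel_lift _) hf, hb, integral_convIntegrand A (hP N) hh hf,
        Matrix.star_mulVec, ← Matrix.dotProduct_mulVec, ← Matrix.star_eq_conjTranspose, star_star]

end Tower

/-! ### Balls in a non-archimedean local field -/

section LocalField

open Topology

variable {k : Type*} [Field k] [ValuativeRel k]

/-- The fractional ideal `ϖᵐ 𝒪` for `m : ℤ`, described by the valuation, as an additive group. -/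
def ball (ϖ : 𝒪[k]) (m : ℤ) : AddSubgroup k where
  carrier := {x | valuation k x ≤ valuation k ϖ ^ m}
  zero_mem' := by simp
  add_mem' hx hy := (valuation k).map_add_le hx hy
  neg_mem' := by simp

variable {ϖ : 𝒪[k]}

theorem mem_ball {m : ℤ} {x : k} : x ∈ ball ϖ m ↔ valuation k x ≤ valuation k ϖ ^ m := Iff.rfl

theorem mem_ball_zero {x : k} : x ∈ ball ϖ 0 ↔ x ∈ 𝒪[k] := by
  rw [mem_ball, zpow_zero, Valuation.mem_integer_iff]

theorem mul_mem_ball (hϖ : Irreducible ϖ) {a b c : ℤ} {x y : k} (hx : x ∈ ball ϖ a)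
    (hy : y ∈ ball ϖ b) (h : a + b = c) : x * y ∈ ball ϖ c := by
  have h0 : valuation k (ϖ : k) ≠ 0 := by simpa using hϖ.ne_zero
  rw [mem_ball, map_mul, ← h, zpow_add₀ h0]
  exact mul_le_mul' hx hy

theorem mul_mem_ball_iff {m : ℤ} {u x : k} (hu : valuation k u = 1) :
    u * x ∈ ball ϖ m ↔ x ∈ ball ϖ m := by
  rw [mem_ball, mem_ball, map_mul, hu, one_mul]

theorem val_ne_zero (hϖ : Irreducible ϖ) : valuation k (ϖ : k) ≠ 0 := by simpa using hϖ.ne_zero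

variable [TopologicalSpace k] [IsNonarchimedeanLocalField k]

theorem val_lt_one_iff_dvd (hϖ : Irreducible ϖ) {x : 𝒪[k]} : valuation k (x : k) < 1 ↔ ϖ ∣ x := by
  have h1 : valuation k (x : k) < 1 ↔ ¬ IsUnit x := by
    rw [(Valuation.integer.integers (valuation k)).isUnit_iff_valuation_eq_one, lt_iff_le_and_ne]
    exact and_iff_right x.2
  rw [h1, ← mem_nonunits_iff, ← IsLocalRing.mem_maximalIdeal, hϖ.maximalIdeal_eq,
    Ideal.mem_span_singleton]

theorem val_lt_one (hϖ : Irreducible ϖ) : valuation k (ϖ : k) < 1 :=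
  (val_lt_one_iff_dvd hϖ).mpr dvd_rfl

theorem exists_val_eq_zpow (hϖ : Irreducible ϖ) {x : k} (hx : x ≠ 0) :
    ∃ m : ℤ, valuation k x = valuation k ϖ ^ m := by
  have key : ∀ x : 𝒪[k], x ≠ 0 → ∃ m : ℕ, valuation k (x : k) = valuation k ϖ ^ m := by
    intro x hx
    obtain ⟨m, u, rfl⟩ := IsDiscreteValuationRing.eq_unit_mul_pow_irreducible hx hϖ
    have hu : valuation k ((u : 𝒪[k]) : k) = 1 :=
      (Valuation.integer.integers (valuation k)).isUnit_iff_valuation_eq_one.mp u.isUnit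
    exact ⟨m, by simp [hu]⟩
  rcases le_total (valuation k x) 1 with h | h
  · obtain ⟨m, hm⟩ := key ⟨x, h⟩ (by simpa [Subtype.ext_iff] using hx)
    exact ⟨m, by simpa using hm⟩
  · have h' : valuation k x⁻¹ ≤ 1 := by
      rw [map_inv₀]; exact inv_le_one_of_one_le₀ h
    obtain ⟨m, hm⟩ := key ⟨x⁻¹, h'⟩ (by simpa [Subtype.ext_iff] using hx)
    refine ⟨-m, ?_⟩
    simp only [map_inv₀] at hm
    rw [zpow_neg, zpow_natCast, ← hm, inv_inv]

theorem zpow_val_le_iff (hϖ : Irreducible ϖ) {a b : ℤ} :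
    valuation k (ϖ : k) ^ a ≤ valuation k ϖ ^ b ↔ b ≤ a :=
  zpow_le_zpow_iff_right_of_lt_one₀ (zero_lt_iff.mpr (val_ne_zero hϖ)) (val_lt_one hϖ)

theorem ball_anti (hϖ : Irreducible ϖ) : Antitone (ball ϖ) := fun _ _ h _ hx =>
  le_trans (mem_ball.mp hx) ((zpow_val_le_iff hϖ).mpr h)

/-- The valuation is discrete: an element outside `ϖᵐ 𝒪` has an inverse in `ϖ^(1-m) 𝒪`. -/
theorem inv_mem_ball (hϖ : Irreducible ϖ) {m : ℤ} {x : k} (hx : x ∉ ball ϖ m) :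
    x⁻¹ ∈ ball ϖ (1 - m) := by
  have hx0 : x ≠ 0 := fun h => hx (h ▸ (ball ϖ m).zero_mem)
  obtain ⟨j, hj⟩ := exists_val_eq_zpow hϖ hx0
  rw [mem_ball, hj, zpow_val_le_iff hϖ] at hx
  rw [mem_ball, map_inv₀, hj, ← zpow_neg, zpow_val_le_iff hϖ]
  lia

theorem exists_mem_ball (hϖ : Irreducible ϖ) (x : k) : ∃ N : ℕ, x ∈ ball ϖ (-N) := by
  by_cases hx : x = 0
  · exact ⟨0, hx ▸ AddSubgroup.zero_mem _⟩
  · obtain ⟨m, hm⟩ := exists_val_eq_zpow hϖ hx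
    refine ⟨m.natAbs, ?_⟩
    rw [mem_ball, hm, zpow_val_le_iff hϖ]
    lia

theorem ball_mem_nhds (hϖ : Irreducible ϖ) (m : ℤ) : (ball ϖ m : Set k) ∈ 𝓝 (0 : k) :=
  (IsValuativeTopology.hasBasis_nhds_zero' k).mem_iff.mpr
    ⟨_, zpow_ne_zero m (val_ne_zero hϖ), fun _ hx => mem_ball.mpr (le_of_lt hx)⟩

theorem isOpen_ball (hϖ : Irreducible ϖ) (m : ℤ) : IsOpen (ball ϖ m : Set k) :=
  AddSubgroup.isOpen_of_mem_nhds _ (ball_mem_nhds hϖ m)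

theorem nhds_zero_basis (hϖ : Irreducible ϖ) (n : ℕ) :
    (𝓝 (0 : k)).HasBasis (fun _ : ℕ => True) fun N => (ball ϖ (n + N : ℕ) : Set k) := by
  refine ⟨fun s => ⟨fun hs => ?_, fun ⟨N, _, hN⟩ =>
    Filter.mem_of_superset (ball_mem_nhds hϖ _) hN⟩⟩
  obtain ⟨γ, hγ, hs⟩ := (IsValuativeTopology.hasBasis_nhds_zero' k).mem_iff.mp hs
  obtain ⟨x, rfl⟩ := valuation_surjective γ
  obtain ⟨m, hm⟩ := exists_val_eq_zpow hϖ (by simpa using hγ : x ≠ 0)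
  refine ⟨m.natAbs + 1, trivial, fun y hy => hs ?_⟩
  rw [SetLike.mem_coe, mem_ball] at hy
  refine lt_of_le_of_lt hy ?_
  rw [hm, zpow_lt_zpow_iff_right_of_lt_one₀ (zero_lt_iff.mpr (val_ne_zero hϖ)) (val_lt_one hϖ)]
  lia

/-- Multiplication by `ϖ⁻ᵐ` and reduction identify `ϖᵐ 𝒪 / ϖᵐ⁺¹ 𝒪` with the residue field. -/
theorem relIndex_ball_succ (hϖ : Irreducible ϖ) (m : ℤ) :
    (ball ϖ (m + 1)).relIndex (ball ϖ m) = Nat.card 𝓀[k] := by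
  have h0 := val_ne_zero hϖ
  have h0' : (ϖ : k) ≠ 0 := by simpa using hϖ.ne_zero
  have hmem : ∀ x ∈ ball ϖ m, (ϖ : k) ^ (-m) * x ∈ 𝒪[k] := fun x hx =>
    mem_ball_zero.mp (mul_mem_ball hϖ (a := -m) (by rw [mem_ball, map_zpow₀]) hx (by ring))
  let f : ball ϖ m →+ 𝓀[k] :=
    { toFun := fun x => IsLocalRing.residue 𝒪[k] ⟨_, hmem x x.2⟩
      map_zero' := by
        rw [← map_zero (IsLocalRing.residue 𝒪[k])]
        congr 1
        ext
        simp
      map_add' := fun x y => by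
        rw [← map_add]
        congr 1
        ext
        simp [mul_add] }
  have hf : ∀ x : ball ϖ m, f x = 0 ↔ (x : k) ∈ ball ϖ (m + 1) := by
    intro x
    change IsLocalRing.residue 𝒪[k] ⟨_, hmem x x.2⟩ = 0 ↔ _
    rw [IsLocalRing.residue_eq_zero_iff, hϖ.maximalIdeal_eq, Ideal.mem_span_singleton]
    constructor
    · rintro ⟨y, hy⟩
      have hy' : (ϖ : k) ^ (-m) * x = ϖ * y := congrArg Subtype.val hy
      have : (x : k) = ϖ ^ (m + 1) * y := by
        rw [zpow_add₀ h0', zpow_one, mul_assoc, ← hy', ← mul_assoc, ← zpow_add₀ h0']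
        simp
      rw [this]
      exact mul_mem_ball hϖ (by rw [mem_ball, map_zpow₀]) (mem_ball_zero.mpr y.2) (by ring)
    · intro hx
      have hy : (ϖ : k) ^ (-(m + 1)) * x ∈ 𝒪[k] := mem_ball_zero.mp
        (mul_mem_ball hϖ (a := -(m + 1)) (by rw [mem_ball, map_zpow₀]) hx (by ring))
      refine ⟨⟨_, hy⟩, Subtype.ext ?_⟩
      rw [Subring.coe_mul]
      simp only
      rw [← mul_assoc]
      congr 1
      rw [← zpow_one_add₀ h0']
      congr 1
      ring
  have hk : f.ker = (ball ϖ (m + 1)).addSubgroupOf (ball ϖ m) := by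
    ext x
    rw [AddMonoidHom.mem_ker, hf, AddSubgroup.mem_addSubgroupOf]
  have hr : f.range = ⊤ := by
    rw [AddMonoidHom.range_eq_top]
    intro y
    obtain ⟨y, rfl⟩ := IsLocalRing.residue_surjective y
    refine ⟨⟨ϖ ^ m * y, mul_mem_ball hϖ (by rw [mem_ball, map_zpow₀]) (mem_ball_zero.mpr y.2)
      (by ring)⟩, ?_⟩
    change IsLocalRing.residue 𝒪[k] _ = _
    congr 1
    ext
    change (ϖ : k) ^ (-m) * (ϖ ^ m * y) = y
    rw [← mul_assoc, ← zpow_add₀ h0']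
    simp
  rw [AddSubgroup.relIndex, ← hk, AddSubgroup.index_ker, hr, AddSubgroup.card_top]

theorem relIndex_ball (hϖ : Irreducible ϖ) (m : ℤ) (j : ℕ) :
    (ball ϖ (m + j)).relIndex (ball ϖ m) = Nat.card 𝓀[k] ^ j := by
  induction j with
  | zero => simp
  | succ j ih =>
    rw [← AddSubgroup.relIndex_mul_relIndex _ (ball ϖ (m + j)) _ (ball_anti hϖ (by simp))
      (ball_anti hϖ (by simp)), ih]
    push_cast
    rw [← add_assoc, relIndex_ball_succ hϖ]
    ring

end LocalField

/-! ### The measure of balls -/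

section LocalField

open Topology

variable {k : Type*} [Field k] [ValuativeRel k] {ϖ : 𝒪[k]}

/-- The measure of a subgroup is the index times the measure of a subgroup of finite index. -/
theorem relIndex_mul_measure {A : Type*} [AddCommGroup A] [MeasurableSpace A] [MeasurableAdd A]
    (μ : Measure A) [μ.IsAddLeftInvariant] {S R : AddSubgroup A} (hSR : S ≤ R)
    (hS : MeasurableSet (S : Set A)) (hfin : S.relIndex R ≠ 0) :
    μ R = S.relIndex R * μ S := by
  have : Finite (R ⧸ S.addSubgroupOf R) := Nat.finite_of_card_ne_zero hfin
  have hmem : ∀ (i : R ⧸ S.addSubgroupOf R) (x : R),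
      (-((Quotient.out i : R) : A) + x ∈ S) ↔ QuotientAddGroup.mk x = i := by
    intro i x
    conv_rhs => rw [← QuotientAddGroup.out_eq' i, eq_comm, QuotientAddGroup.eq]
    rfl
  have hU : (R : Set A) = ⋃ i : R ⧸ S.addSubgroupOf R,
      (fun x => -((Quotient.out i : R) : A) + x) ⁻¹' S := by
    ext x
    simp only [Set.mem_iUnion, Set.mem_preimage, SetLike.mem_coe]
    constructor
    · exact fun hx => ⟨QuotientAddGroup.mk ⟨x, hx⟩, (hmem _ ⟨x, hx⟩).mpr rfl⟩
    · rintro ⟨i, hi⟩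
      simpa using R.add_mem (Quotient.out i : R).2 (hSR hi)
  rw [hU, measure_iUnion]
  · simp only [measure_preimage_add, ENNReal.tsum_const]
    congr 1
    rw [AddSubgroup.relIndex, AddSubgroup.index, ENat.card_eq_coe_natCard]
    rfl
  · intro i j hij
    refine Set.disjoint_left.mpr fun x hi hj => hij ?_
    have hx : x ∈ R := by simpa using R.add_mem (Quotient.out i : R).2 (hSR hi)
    rw [← (hmem i ⟨x, hx⟩).mp hi, ← (hmem j ⟨x, hx⟩).mp hj]
  · exact fun i => (measurable_const_add _) hS

variable [TopologicalSpace k] [IsNonarchimedeanLocalField k]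

theorem isCompact_ball (m : ℤ) : IsCompact (ball ϖ m : Set k) :=
  IsNonarchimedeanLocalField.isCompact_closedBall k _

theorem measure_ball [MeasurableSpace k] [BorelSpace k] {μ : Measure k} [μ.IsAddHaarMeasure]
    (hμ : μ (𝒪[k] : Set k) = 1) (hϖ : Irreducible ϖ) (m : ℕ) :
    μ (ball ϖ m) = ENNReal.ofReal ((Nat.card 𝓀[k] : ℝ) ^ (-m : ℤ)) := by
  have hq : Nat.card 𝓀[k] ≠ 0 := Nat.card_pos.ne'
  have h0 : μ (ball ϖ 0) = 1 := by
    rw [← hμ, show (ball ϖ 0 : Set k) = 𝒪[k] from Set.ext fun x => mem_ball_zero]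
  have h1 := relIndex_ball hϖ 0 m
  rw [zero_add] at h1
  have h2 := relIndex_mul_measure μ (ball_anti hϖ (Nat.cast_nonneg m))
    (isOpen_ball hϖ m).measurableSet (by rw [h1]; exact pow_ne_zero _ hq)
  rw [h0, h1] at h2
  have hpos : (0 : ℝ) < (Nat.card 𝓀[k] : ℝ) ^ m := by positivity
  rw [zpow_neg, zpow_natCast, ENNReal.ofReal_inv_of_pos hpos, ENNReal.ofReal_pow (by positivity),
    ENNReal.ofReal_natCast]
  refine ENNReal.eq_inv_of_mul_eq_one_left ?_
  rw [mul_comm, h2]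
  push_cast
  rfl

theorem secondCountableTopology (hϖ : Irreducible ϖ) : SecondCountableTopology k := by
  let := IsTopologicalAddGroup.rightUniformSpace k
  have := isUniformAddGroup_of_addCommGroup (G := k)
  have h1 : (𝓝 (0 : k)).IsCountablyGenerated := (nhds_zero_basis hϖ 0).isCountablyGenerated
  have : (uniformity k).IsCountablyGenerated :=
    IsUniformAddGroup.uniformity_countably_generated
  let := UniformSpace.pseudoMetricSpace k
  have : SigmaCompactSpace k := ⟨⟨fun N => (ball ϖ (-(N : ℕ)) : Set k),
    fun N => isCompact_ball _, Set.eq_univ_of_forall fun x =>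
      Set.mem_iUnion.mpr (exists_mem_ball hϖ x)⟩⟩
  exact EMetric.secondCountable_of_sigmaCompact k

/-! ### The residue characteristic is not `2` -/

/-- A local field in which `2` is topologically nilpotent and nonzero is an extension of `ℚ₂`:
the maps `ℤ₂ → ℤ / 2ⁿ → 𝒪 / 𝓂ⁿ` define a homomorphism to the `𝓂`-adically complete ring `𝒪`. -/
theorem exists_continuous_ringHom_padic (hϖ : Irreducible ϖ) (h2 : (2 : k) ≠ 0)
    (hlt : valuation k (2 : k) < 1) : ∃ i : ℚ_[2] →+* k, Continuous i := by
  let := IsTopologicalAddGroup.rightUniformSpace k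
  have := isUniformAddGroup_of_addCommGroup (G := k)
  have hdvd2 : ϖ ∣ (2 : 𝒪[k]) := (val_lt_one_iff_dvd hϖ).mp hlt
  have hmem : (2 : 𝒪[k]) ∈ 𝓂[k] := by
    rwa [hϖ.maximalIdeal_eq, Ideal.mem_span_singleton]
  have hdvd : ∀ n, ringChar (𝒪[k] ⧸ 𝓂[k] ^ n) ∣ 2 ^ n := by
    intro n
    rw [← ringChar.spec, Nat.cast_pow, Nat.cast_ofNat,
      ← map_ofNat (Ideal.Quotient.mk (𝓂[k] ^ n)) 2, ← map_pow, Ideal.Quotient.eq_zero_iff_mem]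
    exact Ideal.pow_mem_pow hmem n
  let f : ∀ n, ℤ_[2] →+* 𝒪[k] ⧸ 𝓂[k] ^ n := fun n =>
    (ZMod.castHom (hdvd n) (𝒪[k] ⧸ 𝓂[k] ^ n)).comp (PadicInt.toZModPow n)
  have hf : ∀ {m n : ℕ} (hle : m ≤ n), (Ideal.Quotient.factorPow 𝓂[k] hle).comp (f n) = f m := by
    intro m n hle
    have h1 := PadicInt.zmod_cast_comp_toZModPow (p := 2) m n hle
    simp only [f]
    rw [← h1, ← RingHom.comp_assoc, ← RingHom.comp_assoc]
    congr 1
    exact Subsingleton.elim _ _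
  let g : ℤ_[2] →+* k := (𝒪[k]).subtype.comp (IsAdicComplete.liftRingHom 𝓂[k] f hf)
  have hg1 : ∀ z, valuation k (g z) ≤ 1 := fun z => (IsAdicComplete.liftRingHom 𝓂[k] f hf z).2
  have hg : Function.Injective g := by
    rw [injective_iff_map_eq_zero]
    intro z hz
    by_contra hz0
    rw [PadicInt.unitCoeff_spec hz0, map_mul, map_pow] at hz
    have hu : g (PadicInt.unitCoeff hz0) ≠ 0 :=
      ((PadicInt.unitCoeff hz0).isUnit.map g).ne_zero
    rw [map_natCast] at hz
    exact mul_ne_zero hu (pow_ne_zero _ (by exact_mod_cast h2)) hz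
  let i : ℚ_[2] →+* k := IsFractionRing.lift hg
  have hi : ∀ z : ℤ_[2], i z = g z := fun z => IsFractionRing.lift_algebraMap hg z
  refine ⟨i, continuous_of_continuousAt_zero i.toAddMonoidHom ?_⟩
  rw [ContinuousAt, map_zero, (nhds_zero_basis hϖ 0).tendsto_right_iff]
  intro N _
  have hpow : (2 : ℚ_[2]) ^ N ≠ 0 := pow_ne_zero _ two_ne_zero
  have hball : Metric.closedBall (0 : ℚ_[2]) ‖(2 : ℚ_[2]) ^ N‖ ∈ 𝓝 (0 : ℚ_[2]) :=
    Metric.closedBall_mem_nhds _ (norm_pos_iff.mpr hpow)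
  filter_upwards [hball] with x hx
  rw [mem_closedBall_zero_iff] at hx
  have hx1 : ‖x / 2 ^ N‖ ≤ 1 := by
    rw [norm_div]
    exact div_le_one_of_le₀ hx (norm_nonneg _)
  obtain ⟨z, hz⟩ : ∃ z : ℤ_[2], (z : ℚ_[2]) = x / 2 ^ N := ⟨⟨_, hx1⟩, rfl⟩
  have hix : i x = 2 ^ N * g z := by
    rw [← hi, hz, map_div₀, map_pow, map_ofNat]
    field_simp
  change i x ∈ ball ϖ _
  rw [hix]
  refine mul_mem_ball hϖ (a := N) (b := 0) ?_ (mem_ball_zero.mpr (hg1 _)) (by simp)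
  have h3 : valuation k (2 : k) ≤ valuation k ϖ := by
    obtain ⟨y, hy⟩ := hdvd2
    have hy' : (2 : k) = ϖ * y := congrArg Subtype.val hy
    rw [hy', map_mul]
    exact mul_le_of_le_one_right' y.2
  rw [mem_ball, map_pow, zpow_natCast]
  exact pow_le_pow_left' h3 N

theorem val_two (hϖ : Irreducible ϖ) (hchar : ¬ CharP k 2)
    (hQ2 : ¬ ∃ i : ℚ_[2] →+* k, Continuous i) : valuation k (2 : k) = 1 := by
  have h2 : (2 : k) ≠ 0 := fun h => hchar (CharTwo.of_one_ne_zero_of_two_eq_zero one_ne_zero h)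
  refine le_antisymm ?_ (not_lt.mp fun h => hQ2 (exists_continuous_ringHom_padic hϖ h2 h))
  exact (2 : 𝒪[k]).2

end LocalField

/-! ### Principal units and the function `φ` -/

section PrincipalUnits

/-- `φ(a) - φ(a d) / d'`, which is the coefficient of `t₂` in the phase of `g` divided by that
of `g m` (`phase_mul_conj`), with its denominators cleared. -/
theorem coeff_identity {k : Type*} [Field k] {a d d' : k} (ha : a ≠ 0) (hd : d ≠ 0) (hd' : d' ≠ 0) :
    a * d * d' * ((a - a⁻¹) - (a * d - (a * d)⁻¹) * d'⁻¹) =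
      a ^ 2 * d * (d' - d) - (d * d' - 1) := by
  field_simp
  ring

variable {k : Type*} [Field k] [ValuativeRel k] {ϖ : 𝒪[k]} [TopologicalSpace k]
  [IsNonarchimedeanLocalField k]

theorem val_eq_of_sub_mem (hϖ : Irreducible ϖ) {x y : k} (hy : valuation k y = 1)
    (h : x - y ∈ ball ϖ 1) : valuation k x = 1 := by
  rw [← hy]
  refine Valuation.map_eq_of_sub_lt _ ?_
  rw [hy]
  refine lt_of_le_of_lt (mem_ball.mp h) ?_
  rw [zpow_one]
  exact val_lt_one hϖ

theorem val_eq_one (hϖ : Irreducible ϖ) {x : k} (h : x - 1 ∈ ball ϖ 1) : valuation k x = 1 :=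
  val_eq_of_sub_mem hϖ (map_one _) h

theorem ne_zero_of_sub_one_mem (hϖ : Irreducible ϖ) {x : k} (h : x - 1 ∈ ball ϖ 1) : x ≠ 0 := by
  rintro rfl
  simpa using val_eq_one hϖ h

theorem mul_sub_one_mem (hϖ : Irreducible ϖ) {m : ℤ} {x y : k} (hx1 : x - 1 ∈ ball ϖ 1)
    (hx : x - 1 ∈ ball ϖ m) (hy : y - 1 ∈ ball ϖ m) : x * y - 1 ∈ ball ϖ m := by
  rw [show x * y - 1 = x * (y - 1) + (x - 1) by ring]
  exact (ball ϖ m).add_mem ((mul_mem_ball_iff (val_eq_one hϖ hx1)).mpr hy) hx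

theorem inv_sub_one_mem (hϖ : Irreducible ϖ) {m : ℤ} {x : k} (hx1 : x - 1 ∈ ball ϖ 1)
    (hx : x - 1 ∈ ball ϖ m) : x⁻¹ - 1 ∈ ball ϖ m := by
  rw [← mul_mem_ball_iff (val_eq_one hϖ hx1), mul_sub,
    mul_inv_cancel₀ (ne_zero_of_sub_one_mem hϖ hx1), mul_one, ← neg_sub]
  exact (ball ϖ m).neg_mem hx

/-- If `d, d' ≡ 1` then `φ(a) ≡ φ(a d) / d'`. -/
theorem coeff_mem_ball (hϖ : Irreducible ϖ) {m : ℤ} {a d d' : k} (ha : a - 1 ∈ ball ϖ 1)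
    (hd : d - 1 ∈ ball ϖ 1) (hd' : d' - 1 ∈ ball ϖ 1) (hdm : d - 1 ∈ ball ϖ m)
    (hdm' : d' - 1 ∈ ball ϖ m) :
    (a - a⁻¹) - (a * d - (a * d)⁻¹) * d'⁻¹ ∈ ball ϖ m := by
  have h1 : valuation k (a * d * d') = 1 := by
    rw [map_mul, map_mul, val_eq_one hϖ ha, val_eq_one hϖ hd, val_eq_one hϖ hd', one_mul, one_mul]
  have h2 : valuation k (a ^ 2 * d) = 1 := by
    rw [map_mul, map_pow, val_eq_one hϖ ha, val_eq_one hϖ hd, one_pow, one_mul]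
  rw [← mul_mem_ball_iff h1, coeff_identity (ne_zero_of_sub_one_mem hϖ ha)
    (ne_zero_of_sub_one_mem hϖ hd) (ne_zero_of_sub_one_mem hϖ hd')]
  refine (ball ϖ m).sub_mem ((mul_mem_ball_iff h2).mpr ?_) (mul_sub_one_mem hϖ hd hdm hdm')
  rw [show d' - d = (d' - 1) - (d - 1) by ring]
  exact (ball ϖ m).sub_mem hdm' hdm

/-- Conversely, if `φ(a) ≡ φ(a d) / d'` and `φ(a') ≡ φ(a' d') / d` then `d, d' ≡ 1`. Subtracting
the two congruences leaves `(d' - d) (a² d + a'² d')`, whose second factor is `≡ 2`. -/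
theorem sub_one_mem_of_coeff (hϖ : Irreducible ϖ) (h2 : valuation k (2 : k) = 1) {m : ℤ}
    {a a' d d' : k} (ha : a - 1 ∈ ball ϖ 1) (ha' : a' - 1 ∈ ball ϖ 1)
    (hd : d - 1 ∈ ball ϖ 1) (hd' : d' - 1 ∈ ball ϖ 1)
    (he : (a - a⁻¹) - (a * d - (a * d)⁻¹) * d'⁻¹ ∈ ball ϖ m)
    (he' : (a' - a'⁻¹) - (a' * d' - (a' * d')⁻¹) * d⁻¹ ∈ ball ϖ m) :
    d - 1 ∈ ball ϖ m ∧ d' - 1 ∈ ball ϖ m := by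
  have ha0 := ne_zero_of_sub_one_mem hϖ ha
  have ha0' := ne_zero_of_sub_one_mem hϖ ha'
  have hd0 := ne_zero_of_sub_one_mem hϖ hd
  have hd0' := ne_zero_of_sub_one_mem hϖ hd'
  have hsq : ∀ {x y : k}, x - 1 ∈ ball ϖ 1 → y - 1 ∈ ball ϖ 1 → x ^ 2 * y - 1 ∈ ball ϖ 1 := by
    intro x y hx hy
    rw [pow_two]
    have hxx := mul_sub_one_mem hϖ hx hx hx
    exact mul_sub_one_mem hϖ hxx hxx hy
  have h1 : valuation k (a * d * d') = 1 := by
    rw [map_mul, map_mul, val_eq_one hϖ ha, val_eq_one hϖ hd, val_eq_one hϖ hd', one_mul, one_mul]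
  have h1' : valuation k (a' * d' * d) = 1 := by
    rw [map_mul, map_mul, val_eq_one hϖ ha', val_eq_one hϖ hd, val_eq_one hϖ hd', one_mul, one_mul]
  rw [← mul_mem_ball_iff h1, coeff_identity ha0 hd0 hd0'] at he
  rw [← mul_mem_ball_iff h1', coeff_identity ha0' hd0' hd0] at he'
  have h3 : valuation k (a ^ 2 * d + a' ^ 2 * d') = 1 := by
    refine val_eq_of_sub_mem hϖ h2 ?_
    rw [show a ^ 2 * d + a' ^ 2 * d' - 2 = (a ^ 2 * d - 1) + (a' ^ 2 * d' - 1) by ring]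
    exact (ball ϖ 1).add_mem (hsq ha hd) (hsq ha' hd')
  have hdd : d' - d ∈ ball ϖ m := by
    rw [← mul_mem_ball_iff h3]
    have := (ball ϖ m).sub_mem he he'
    convert! this using 1
    ring
  have h4 : valuation k (d + 1) = 1 := by
    refine val_eq_of_sub_mem hϖ h2 ?_
    rwa [show d + 1 - 2 = d - 1 by ring]
  have hd1 : d - 1 ∈ ball ϖ m := by
    rw [← mul_mem_ball_iff h4]
    have h5 : valuation k (a ^ 2 * d) = 1 := val_eq_one hϖ (hsq ha hd)
    have h6 := (ball ϖ m).sub_mem ((mul_mem_ball_iff h5).mpr hdd) he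
    have h7 := (ball ϖ m).sub_mem h6 ((mul_mem_ball_iff (val_eq_one hϖ hd)).mpr hdd)
    convert! h7 using 1
    ring
  refine ⟨hd1, ?_⟩
  rw [show d' - 1 = (d' - d) + (d - 1) by ring]
  exact (ball ϖ m).add_mem hdd hd1

/-- The increment of `φ` at `a` under multiplication by `1 + y` is `≡ 2 y`. -/
theorem phi_increment (hϖ : Irreducible ϖ) {a y r : k} (ha : a - 1 ∈ ball ϖ 1)
    (hy : y ∈ ball ϖ 1) (hyr : y * r ∈ ball ϖ (-1)) :
    ((a * (1 + y) - (a * (1 + y))⁻¹) - (a - a⁻¹)) * r - 2 * y * r ∈ ball ϖ 0 := by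
  have hu : (1 + y) - 1 ∈ ball ϖ 1 := by rwa [add_sub_cancel_left]
  have ha0 := ne_zero_of_sub_one_mem hϖ ha
  have hu0 := ne_zero_of_sub_one_mem hϖ hu
  have h1 := mul_sub_one_mem hϖ ha ha hu
  have h2 := inv_sub_one_mem hϖ h1 h1
  have h3 := mul_mem_ball hϖ ((ball ϖ 1).add_mem ha h2) hyr (c := 0) (by norm_num)
  convert! h3 using 1
  field_simp
  ring

variable (Ψ : AddChar k Circle)

/-- The character `Ψ` is nontrivial on `e ϖ⁻ᵐ 𝒪` if `e ∉ ϖᵐ 𝒪`. -/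
theorem exists_char_ne_one (hϖ : Irreducible ϖ) (hΨ' : ∃ x ∈ 𝒪[k], Ψ ((ϖ : k)⁻¹ * x) ≠ 1) {m : ℤ}
    {e : k} (he : e ∉ ball ϖ m) : ∃ t ∈ ball ϖ (-m), e * t ∈ ball ϖ (-1) ∧ Ψ (e * t) ≠ 1 := by
  obtain ⟨x, hx, hΨx⟩ := hΨ'
  have he0 : e ≠ 0 := fun h => he (h ▸ (ball ϖ m).zero_mem)
  have h1 : (ϖ : k)⁻¹ * x ∈ ball ϖ (-1) := by
    refine mul_mem_ball hϖ (a := -1) ?_ (mem_ball_zero.mpr hx) (by norm_num)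
    rw [mem_ball, map_inv₀, zpow_neg_one]
  have h2 : e * (e⁻¹ * ((ϖ : k)⁻¹ * x)) = (ϖ : k)⁻¹ * x := by field_simp
  refine ⟨e⁻¹ * ((ϖ : k)⁻¹ * x), mul_mem_ball hϖ (inv_mem_ball hϖ he) h1 (by ring), ?_, ?_⟩
  · rwa [h2]
  · rwa [h2]

end PrincipalUnits

/-! ### The phase and its twists -/

section Phase

variable {k : Type*} [Field k] [ValuativeRel k] {ϖ : 𝒪[k]} {n : ℕ}

theorem U.toField_mul (a b : U ϖ n) : U.toField (a * b) = U.toField a * U.toField b := rfl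

theorem U.toField_one : U.toField (1 : U ϖ n) = 1 := rfl

theorem U.toField_inv (a : U ϖ n) : U.toField a⁻¹ = (U.toField a)⁻¹ := by
  refine eq_inv_of_mul_eq_one_left ?_
  rw [← U.toField_mul, inv_mul_cancel, U.toField_one]

theorem U.smul_mk (a : U ϖ n) (t : k) :
    a • (Submodule.Quotient.mk t : Gam ϖ n) = Submodule.Quotient.mk (U.toField a * t) := rfl

theorem mem_fracIdeal (hϖ : Irreducible ϖ) {x : k} : x ∈ fracIdeal ϖ n ↔ x ∈ ball ϖ (-n) := by
  have h0 : (ϖ : k) ≠ 0 := by simpa using hϖ.ne_zero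
  rw [fracIdeal, Submodule.mem_span_singleton]
  constructor
  · rintro ⟨y, rfl⟩
    refine mul_mem_ball hϖ (a := 0) (mem_ball_zero.mpr y.2) (b := -n) ?_ (by ring)
    rw [mem_ball, map_inv₀, map_pow, zpow_neg, zpow_natCast]
  · intro hx
    have h1 : (ϖ : k) ^ n * x ∈ 𝒪[k] := by
      refine mem_ball_zero.mp (mul_mem_ball hϖ (a := n) ?_ hx (by ring))
      rw [mem_ball, map_pow, zpow_natCast]
    refine ⟨⟨_, h1⟩, ?_⟩
    rw [Subring.smul_def, smul_eq_mul]
    field_simp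

theorem mk_eq_zero_iff (hϖ : Irreducible ϖ) {t : k} :
    (Submodule.Quotient.mk t : Gam ϖ n) = 0 ↔ t ∈ ball ϖ (-n) := by
  rw [Submodule.Quotient.mk_eq_zero, mem_fracIdeal hϖ]

theorem U.sub_one_mem (hϖ : Irreducible ϖ) (a : U ϖ n) : U.toField a - 1 ∈ ball ϖ n := by
  obtain ⟨a, x, hx⟩ := a
  have h1 : U.toField (⟨a, x, hx⟩ : U ϖ n) = 1 + (ϖ : k) ^ n * x := by
    simp only [U.toField]
    rw [hx]
    simp
  rw [h1, add_sub_cancel_left]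
  refine mul_mem_ball hϖ (a := n) ?_ (mem_ball_zero.mpr x.2) (by ring)
  rw [mem_ball, map_pow, zpow_natCast]

/-- The phase of `x` divided by the phase of `x m`, where `m = ((d₁, [r₁]), (d₂, [r₂]))`. -/
theorem phase_mul_conj (hϖ : Irreducible ϖ) (Ψ : AddChar k Circle) (hΨ : ∀ x ∈ 𝒪[k], Ψ x = 1)
    (a₁ a₂ d₁ d₂ : U ϖ n) (x₁ x₂ r₁ r₂ : k) :
    phase Ψ ((⟨a₁, Submodule.Quotient.mk x₁⟩, ⟨a₂, Submodule.Quotient.mk x₂⟩) : X ϖ n × X ϖ n) *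
      starRingEnd ℂ (phase Ψ
        (((⟨a₁, Submodule.Quotient.mk x₁⟩, ⟨a₂, Submodule.Quotient.mk x₂⟩) : X ϖ n × X ϖ n) *
        (⟨d₁, Submodule.Quotient.mk r₁⟩, ⟨d₂, Submodule.Quotient.mk r₂⟩))) =
      (Ψ ((phi a₁ - phi (a₁ * d₁) * (U.toField d₂)⁻¹) * x₂ -
        (phi a₂ - phi (a₂ * d₂) * (U.toField d₁)⁻¹) * x₁ -
        (phi (a₁ * d₁) * r₂ - phi (a₂ * d₂) * r₁)) : ℂ) := by
  have h1 : ((⟨a₁, Submodule.Quotient.mk x₁⟩, ⟨a₂, Submodule.Quotient.mk x₂⟩) : X ϖ n × X ϖ n) *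
        (⟨d₁, Submodule.Quotient.mk r₁⟩, ⟨d₂, Submodule.Quotient.mk r₂⟩) =
      (⟨a₁ * d₁, Submodule.Quotient.mk ((U.toField d₁)⁻¹ * x₁ + r₁)⟩,
        ⟨a₂ * d₂, Submodule.Quotient.mk ((U.toField d₂)⁻¹ * x₂ + r₂)⟩) := by
    rw [← U.toField_inv, ← U.toField_inv]
    rfl
  rw [h1, phase_eq hϖ.ne_zero Ψ hΨ, phase_eq hϖ.ne_zero Ψ hΨ, ← Circle.coe_inv_eq_conj,
    ← Circle.coe_mul, ← AddChar.map_neg_eq_inv, ← AddChar.map_add_eq_mul]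
  congr 2
  ring

theorem norm_phase (Ψ : AddChar k Circle) (g : X ϖ n × X ϖ n) : ‖phase Ψ g‖ = 1 :=
  Circle.norm_coe _

end Phase

/-! ### The compact open subgroups of `X_n` -/

section Subgroups

variable {k : Type*} [Field k] [ValuativeRel k] {ϖ : 𝒪[k]} {n : ℕ}

/-- The finite subgroup `ϖ⁻ᵐ 𝒪 / ϖ⁻ⁿ 𝒪` of `Γ_n`, for `m ≥ n`. -/
def gamBall (ϖ : 𝒪[k]) (n m : ℕ) : AddSubgroup (Gam ϖ n) :=
  (ball ϖ (-m)).map (fracIdeal ϖ n).mkQ.toAddMonoidHom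

theorem char_eq_of_sub_mem {Ψ : AddChar k Circle} (hΨ : ∀ x ∈ 𝒪[k], Ψ x = 1) {x y : k}
    (h : x - y ∈ ball ϖ 0) :
    Ψ x = Ψ y := by
  rw [← sub_add_cancel x y, AddChar.map_add_eq_mul, hΨ _ (mem_ball_zero.mp h), one_mul]

variable [TopologicalSpace k] [IsNonarchimedeanLocalField k] {m : ℕ}

theorem mk_mem_gamBall (hϖ : Irreducible ϖ) (hm : n ≤ m) {t : k} :
    (Submodule.Quotient.mk t : Gam ϖ n) ∈ gamBall ϖ n m ↔ t ∈ ball ϖ (-m) := by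
  constructor
  · rintro ⟨s, hs, hst⟩
    have h1 : s - t ∈ ball ϖ (-n) := by
      rw [← mem_fracIdeal hϖ]
      exact (Submodule.Quotient.eq _).mp hst
    have h2 := ball_anti hϖ (by lia : -(m : ℤ) ≤ -n) h1
    have h3 := (ball ϖ (-m)).sub_mem hs h2
    rwa [sub_sub_cancel] at h3
  · exact fun ht => ⟨t, ht, rfl⟩

theorem val_toField (hϖ : Irreducible ϖ) (hn : 1 ≤ n) (a : U ϖ n) :
    valuation k (U.toField a) = 1 :=
  val_eq_one hϖ (ball_anti hϖ (by exact_mod_cast hn) (U.sub_one_mem hϖ a))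

theorem smul_mem_gamBall (hϖ : Irreducible ϖ) (hn : 1 ≤ n) (hm : n ≤ m) (a : U ϖ n)
    {t : Gam ϖ n} (ht : t ∈ gamBall ϖ n m) : a • t ∈ gamBall ϖ n m := by
  obtain ⟨t, rfl⟩ := Submodule.Quotient.mk_surjective _ t
  rw [mk_mem_gamBall hϖ hm] at ht
  rwa [U.smul_mk, mk_mem_gamBall hϖ hm, mul_mem_ball_iff (val_toField hϖ hn a)]

/-- The compact open subgroup `U_n ⋉ ϖ⁻ᵐ 𝒪 / ϖ⁻ⁿ 𝒪` of `X_n`, for `m ≥ n`. -/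
def largeX (hϖ : Irreducible ϖ) (hn : 1 ≤ n) (hm : n ≤ m) : Subgroup (X ϖ n) where
  carrier := {g | g.t ∈ gamBall ϖ n m}
  one_mem' := (gamBall ϖ n m).zero_mem
  mul_mem' hg hg' := (gamBall ϖ n m).add_mem (smul_mem_gamBall hϖ hn hm _ hg) hg'
  inv_mem' hg := (gamBall ϖ n m).neg_mem (smul_mem_gamBall hϖ hn hm _ hg)

/-- The compact open subgroup `U_m ⋉ 0` of `X_n`, for `m ≥ n`. -/
def smallX (hϖ : Irreducible ϖ) (hn : 1 ≤ n) (m : ℕ) : Subgroup (X ϖ n) where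
  carrier := {g | U.toField g.a - 1 ∈ ball ϖ m ∧ g.t = 0}
  one_mem' := by simp [U.toField_one]
  mul_mem' := by
    rintro g g' ⟨h1, h2⟩ ⟨h3, h4⟩
    refine ⟨?_, by simp [h2, h4]⟩
    rw [X.mul_a, U.toField_mul]
    exact mul_sub_one_mem hϖ (ball_anti hϖ (by exact_mod_cast hn) (U.sub_one_mem hϖ g.a)) h1 h3
  inv_mem' := by
    rintro g ⟨h1, h2⟩
    refine ⟨?_, by simp [h2]⟩
    rw [X.inv_a, U.toField_inv]
    exact inv_sub_one_mem hϖ (ball_anti hϖ (by exact_mod_cast hn) (U.sub_one_mem hϖ g.a)) h1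

theorem mem_largeX (hϖ : Irreducible ϖ) (hn : 1 ≤ n) (hm : n ≤ m) {g : X ϖ n} :
    g ∈ largeX hϖ hn hm ↔ g.t ∈ gamBall ϖ n m := Iff.rfl

theorem mem_smallX (hϖ : Irreducible ϖ) (hn : 1 ≤ n) {g : X ϖ n} :
    g ∈ smallX hϖ hn m ↔ U.toField g.a - 1 ∈ ball ϖ m ∧ g.t = 0 := Iff.rfl

theorem smul_eq_of_sub_one_mem (hϖ : Irreducible ϖ) (hm : n ≤ m) {u : U ϖ n}
    (hu : U.toField u - 1 ∈ ball ϖ m) {t : Gam ϖ n} (ht : t ∈ gamBall ϖ n m) : u • t = t := by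
  obtain ⟨t, rfl⟩ := Submodule.Quotient.mk_surjective _ t
  rw [mk_mem_gamBall hϖ hm] at ht
  rw [U.smul_mk, Submodule.Quotient.eq, mem_fracIdeal hϖ,
    show U.toField u * t - t = (U.toField u - 1) * t by ring]
  exact ball_anti hϖ (by lia : -(n : ℤ) ≤ 0) (mul_mem_ball hϖ hu ht (by ring))

/-- The subgroup `U_m ⋉ 0` is normal in `U_n ⋉ ϖ⁻ᵐ 𝒪 / ϖ⁻ⁿ 𝒪`, since `U_m` acts trivially on
`ϖ⁻ᵐ 𝒪 / ϖ⁻ⁿ 𝒪`. -/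
theorem conj_mem_smallX (hϖ : Irreducible ϖ) (hn : 1 ≤ n) (hm : n ≤ m) {g u : X ϖ n}
    (hg : g ∈ largeX hϖ hn hm) (hu : u ∈ smallX hϖ hn m) : g * u * g⁻¹ ∈ smallX hϖ hn m := by
  obtain ⟨h1, h2⟩ := hu
  constructor
  · rw [X.mul_a, X.mul_a, X.inv_a, mul_right_comm, mul_inv_cancel, one_mul]
    exact h1
  · have h3 := ((smallX hϖ hn m).inv_mem ⟨h1, h2⟩ : u⁻¹ ∈ _).1
    rw [X.mul_t, X.mul_t, h2, add_zero, X.inv_a, inv_inv, X.inv_t]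
    rw [smul_eq_of_sub_one_mem hϖ hm (u := u.a⁻¹) h3 hg, add_neg_cancel]

variable {Ψ : AddChar k Circle}

/-- The coefficient of `t₂` or `t₁` in `phase_mul_conj` for a class with components in `U_m`. -/
theorem coeff_phi_mem (hϖ : Irreducible ϖ) (hn : 1 ≤ n) (a d d' : U ϖ n)
    (hd : U.toField d - 1 ∈ ball ϖ m) (hd' : U.toField d' - 1 ∈ ball ϖ m) :
    phi a - phi (a * d) * (U.toField d')⁻¹ ∈ ball ϖ m := by
  have h := fun a : U ϖ n => ball_anti hϖ (by exact_mod_cast hn : (1 : ℤ) ≤ n) (U.sub_one_mem hϖ a)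
  exact coeff_mem_ball hϖ (h a) (h d) (h d') hd hd'

theorem phase_mul_small (hϖ : Irreducible ϖ) (hn : 1 ≤ n) (hm : n ≤ m)
    (hΨ : ∀ x ∈ 𝒪[k], Ψ x = 1) (g u : X ϖ n × X ϖ n)
    (hg : g ∈ (largeX hϖ hn hm).prod (largeX hϖ hn hm))
    (hu : u ∈ (smallX hϖ hn m).prod (smallX hϖ hn m)) : phase Ψ (g * u) = phase Ψ g := by
  obtain ⟨⟨a₁, t₁⟩, ⟨a₂, t₂⟩⟩ := g
  obtain ⟨⟨u₁, r₁⟩, ⟨u₂, r₂⟩⟩ := u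
  obtain ⟨⟨hu₁, hr₁⟩, ⟨hu₂, hr₂⟩⟩ := hu
  simp only at hu₁ hu₂ hr₁ hr₂
  subst hr₁ hr₂
  obtain ⟨t₁, rfl⟩ := Submodule.Quotient.mk_surjective _ t₁
  obtain ⟨t₂, rfl⟩ := Submodule.Quotient.mk_surjective _ t₂
  obtain ⟨ht₁, ht₂⟩ := hg
  replace ht₁ := (mk_mem_gamBall hϖ hm).mp ht₁
  replace ht₂ := (mk_mem_gamBall hϖ hm).mp ht₂
  have h1 := phase_mul_conj hϖ Ψ hΨ a₁ a₂ u₁ u₂ t₁ t₂ 0 0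
  have h2 := mul_mem_ball hϖ (coeff_phi_mem hϖ hn a₁ u₁ u₂ hu₁ hu₂) ht₂ (c := 0) (by ring)
  have h3 := mul_mem_ball hϖ (coeff_phi_mem hϖ hn a₂ u₂ u₁ hu₂ hu₁) ht₁ (c := 0) (by ring)
  rw [mul_zero, mul_zero, sub_zero, sub_zero,
    hΨ _ (mem_ball_zero.mp ((ball ϖ 0).sub_mem h2 h3))] at h1
  rw [Submodule.Quotient.mk_zero] at h1
  -- both phases have absolute value `1`, so `p * conj p' = 1` means `p = p'`
  set p := phase Ψ ((⟨a₁, Submodule.Quotient.mk t₁⟩, ⟨a₂, Submodule.Quotient.mk t₂⟩) :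
    X ϖ n × X ϖ n)
  set p' := phase Ψ (((⟨a₁, Submodule.Quotient.mk t₁⟩, ⟨a₂, Submodule.Quotient.mk t₂⟩) :
    X ϖ n × X ϖ n) * (⟨u₁, 0⟩, ⟨u₂, 0⟩)) with hp'
  have h4 : starRingEnd ℂ p' * p' = 1 := by
    rw [mul_comm, Complex.mul_conj, Complex.normSq_eq_norm_sq, hp', norm_phase]
    simp
  calc p' = (p * starRingEnd ℂ p') * p' := by rw [h1]; simp
    _ = p := by rw [mul_assoc, h4, mul_one]

theorem exists_U_toField (hϖ : Irreducible ϖ) (hn : 1 ≤ n) {y : k} (hy : y ∈ ball ϖ n) :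
    ∃ u : U ϖ n, U.toField u = 1 + y := by
  have h0 : (ϖ : k) ≠ 0 := by simpa using hϖ.ne_zero
  have hz : ((ϖ : k) ^ n)⁻¹ * y ∈ 𝒪[k] := by
    refine mem_ball_zero.mp (mul_mem_ball hϖ (a := -n) ?_ hy (by ring))
    rw [mem_ball, map_inv₀, map_pow, zpow_neg, zpow_natCast]
  have hv : valuation k (1 + y) = 1 :=
    val_eq_one hϖ (by rw [add_sub_cancel_left]; exact ball_anti hϖ (by exact_mod_cast hn) hy)
  have hu : IsUnit (⟨1 + y, hv.le⟩ : 𝒪[k]) :=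
    (Valuation.integer.integers (valuation k)).isUnit_iff_valuation_eq_one.mpr hv
  refine ⟨⟨hu.unit, ⟨_, hz⟩, ?_⟩, rfl⟩
  ext
  simp only [IsUnit.unit_spec, Subring.coe_add, Subring.coe_one, Subring.coe_mul,
    SubmonoidClass.coe_pow]
  field_simp

/-- The elements `((1, [t₁]), (1, [t₂]))` of `(U_n ⋉ ϖ⁻ᵐ 𝒪 / ϖ⁻ⁿ 𝒪)²`. -/
def transX (hϖ : Irreducible ϖ) (hn : 1 ≤ n) (hm : n ≤ m) : Subgroup (X ϖ n × X ϖ n) where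
  carrier := {g | g ∈ (largeX hϖ hn hm).prod (largeX hϖ hn hm) ∧ g.1.a = 1 ∧ g.2.a = 1}
  one_mem' := ⟨Subgroup.one_mem _, rfl, rfl⟩
  mul_mem' := by
    rintro g g' ⟨h1, h2, h3⟩ ⟨h1', h2', h3'⟩
    refine ⟨Subgroup.mul_mem _ h1 h1', ?_, ?_⟩
    · rw [Prod.fst_mul, X.mul_a, h2, h2', one_mul]
    · rw [Prod.snd_mul, X.mul_a, h3, h3', one_mul]
  inv_mem' := by
    rintro g ⟨h1, h2, h3⟩
    refine ⟨Subgroup.inv_mem _ h1, ?_, ?_⟩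
    · rw [Prod.fst_inv, X.inv_a, h2, inv_one]
    · rw [Prod.snd_inv, X.inv_a, h3, inv_one]

/-- For a class `m = ((d₁, [r₁]), (d₂, [r₂]))` with `(d₁, d₂) ∉ U_m²` the product
`P(g) conj P(g m)` is a nontrivial character in the variable `(t₁, t₂)`. -/
theorem exists_twist_of_not_mem (hϖ : Irreducible ϖ) (h2 : valuation k (2 : k) = 1) (hn : 1 ≤ n)
    (hm : n ≤ m) (hΨ : ∀ x ∈ 𝒪[k], Ψ x = 1) (hΨ' : ∃ x ∈ 𝒪[k], Ψ ((ϖ : k)⁻¹ * x) ≠ 1)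
    (d : X ϖ n × X ϖ n)
    (hd : ¬ (U.toField d.1.a - 1 ∈ ball ϖ m ∧ U.toField d.2.a - 1 ∈ ball ϖ m))
    (g : X ϖ n × X ϖ n) : ∃ t ∈ transX hϖ hn hm, ∃ ζ : ℂ, ζ ≠ 1 ∧ ∀ s ∈ transX hϖ hn hm,
      phase Ψ (g * s * t) * starRingEnd ℂ (phase Ψ (g * s * t * d)) =
        ζ * (phase Ψ (g * s) * starRingEnd ℂ (phase Ψ (g * s * d))) := by
  obtain ⟨⟨d₁, r₁⟩, ⟨d₂, r₂⟩⟩ := d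
  obtain ⟨⟨a₁, x₁⟩, ⟨a₂, x₂⟩⟩ := g
  obtain ⟨r₁, rfl⟩ := Submodule.Quotient.mk_surjective _ r₁
  obtain ⟨r₂, rfl⟩ := Submodule.Quotient.mk_surjective _ r₂
  obtain ⟨x₁, rfl⟩ := Submodule.Quotient.mk_surjective _ x₁
  obtain ⟨x₂, rfl⟩ := Submodule.Quotient.mk_surjective _ x₂
  simp only at hd
  set e₂ := phi a₁ - phi (a₁ * d₁) * (U.toField d₂)⁻¹ with he₂
  set e₁ := phi a₂ - phi (a₂ * d₂) * (U.toField d₁)⁻¹ with he₁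
  have h1 := fun a : U ϖ n => ball_anti hϖ (by exact_mod_cast hn : (1 : ℤ) ≤ n) (U.sub_one_mem hϖ a)
  obtain ⟨t₁, ht₁, t₂, ht₂, hne⟩ : ∃ t₁ ∈ ball ϖ (-m), ∃ t₂ ∈ ball ϖ (-m),
      Ψ (e₂ * t₂ - e₁ * t₁) ≠ 1 := by
    by_cases hm₂ : e₂ ∈ ball ϖ m
    · by_cases hm₁ : e₁ ∈ ball ϖ m
      · exact absurd (sub_one_mem_of_coeff hϖ h2 (h1 a₁) (h1 a₂) (h1 d₁) (h1 d₂) hm₂ hm₁) hd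
      · obtain ⟨t, ht, -, hne⟩ := exists_char_ne_one Ψ hϖ hΨ' hm₁
        refine ⟨-t, (ball ϖ _).neg_mem ht, 0, (ball ϖ _).zero_mem, ?_⟩
        simpa using hne
    · obtain ⟨t, ht, -, hne⟩ := exists_char_ne_one Ψ hϖ hΨ' hm₂
      refine ⟨0, (ball ϖ _).zero_mem, t, ht, ?_⟩
      simpa using hne
  refine ⟨(⟨1, Submodule.Quotient.mk t₁⟩, ⟨1, Submodule.Quotient.mk t₂⟩),
    ⟨⟨(mk_mem_gamBall hϖ hm).mpr ht₁, (mk_mem_gamBall hϖ hm).mpr ht₂⟩, rfl, rfl⟩,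
    (Ψ (e₂ * t₂ - e₁ * t₁) : ℂ), fun h => hne (Circle.ext h), ?_⟩
  rintro ⟨⟨s₁, y₁⟩, ⟨s₂, y₂⟩⟩ ⟨-, h3, h4⟩
  obtain ⟨y₁, rfl⟩ := Submodule.Quotient.mk_surjective _ y₁
  obtain ⟨y₂, rfl⟩ := Submodule.Quotient.mk_surjective _ y₂
  simp only at h3 h4
  subst h3 h4
  have h5 : ∀ (a : U ϖ n) (x y : k), (⟨a, Submodule.Quotient.mk x⟩ : X ϖ n) *
      ⟨1, Submodule.Quotient.mk y⟩ = ⟨a, Submodule.Quotient.mk (x + y)⟩ := by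
    intro a x y
    ext1
    · simp
    · simp [Submodule.Quotient.mk_add]
  rw [Prod.mk_mul_mk, Prod.mk_mul_mk, h5, h5, h5, h5, phase_mul_conj hϖ Ψ hΨ,
    phase_mul_conj hϖ Ψ hΨ, ← Circle.coe_mul, ← AddChar.map_add_eq_mul, ← he₁, ← he₂]
  congr 2
  ring

/-- For a class `m = ((d₁, [r₁]), (d₂, [r₂])) ≠ 1` with `(d₁, d₂) ∈ U_m²` the product
`P(g) conj P(g m)` is `Ψ(φ(a₂ d₂) r₁ - φ(a₁ d₁) r₂)`, which is multiplied by `Ψ(2 y r₁)` or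
`Ψ(-2 y r₂)` under a translation by `1 + y` in `a₂` or `a₁`. -/
theorem exists_twist_of_mem (hϖ : Irreducible ϖ) (h2 : valuation k (2 : k) = 1) (hn : 1 ≤ n)
    (hm : n ≤ m) (hΨ : ∀ x ∈ 𝒪[k], Ψ x = 1) (hΨ' : ∃ x ∈ 𝒪[k], Ψ ((ϖ : k)⁻¹ * x) ≠ 1)
    (d : X ϖ n × X ϖ n) (hd₁ : U.toField d.1.a - 1 ∈ ball ϖ m)
    (hd₂ : U.toField d.2.a - 1 ∈ ball ϖ m) (hr : ¬ (d.1.t = 0 ∧ d.2.t = 0)) :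
    ∃ t ∈ (largeX hϖ hn hm).prod (largeX hϖ hn hm), ∃ ζ : ℂ, ζ ≠ 1 ∧
      ∀ g ∈ (largeX hϖ hn hm).prod (largeX hϖ hn hm),
      phase Ψ (g * t) * starRingEnd ℂ (phase Ψ (g * t * d)) =
        ζ * (phase Ψ g * starRingEnd ℂ (phase Ψ (g * d))) := by
  obtain ⟨⟨d₁, r₁⟩, ⟨d₂, r₂⟩⟩ := d
  obtain ⟨r₁, rfl⟩ := Submodule.Quotient.mk_surjective _ r₁
  obtain ⟨r₂, rfl⟩ := Submodule.Quotient.mk_surjective _ r₂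
  simp only [mk_eq_zero_iff hϖ] at hd₁ hd₂ hr
  have h1 := fun a : U ϖ n => ball_anti hϖ (by exact_mod_cast hn : (1 : ℤ) ≤ n) (U.sub_one_mem hϖ a)
  -- the value of the product on `H`
  have hQ : ∀ (a₁ a₂ : U ϖ n) (x₁ x₂ : k), x₁ ∈ ball ϖ (-m) → x₂ ∈ ball ϖ (-m) →
      phase Ψ ((⟨a₁, Submodule.Quotient.mk x₁⟩, ⟨a₂, Submodule.Quotient.mk x₂⟩) : X ϖ n × X ϖ n) *
      starRingEnd ℂ (phase Ψ
        (((⟨a₁, Submodule.Quotient.mk x₁⟩, ⟨a₂, Submodule.Quotient.mk x₂⟩) : X ϖ n × X ϖ n) *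
        (⟨d₁, Submodule.Quotient.mk r₁⟩, ⟨d₂, Submodule.Quotient.mk r₂⟩))) =
      (Ψ (phi (a₂ * d₂) * r₁ - phi (a₁ * d₁) * r₂) : ℂ) := by
    intro a₁ a₂ x₁ x₂ hx₁ hx₂
    rw [phase_mul_conj hϖ Ψ hΨ]
    congr 1
    refine char_eq_of_sub_mem (ϖ := ϖ) hΨ ?_
    have h3 := mul_mem_ball hϖ (coeff_phi_mem hϖ hn a₁ d₁ d₂ hd₁ hd₂) hx₂ (c := 0) (by ring)
    have h4 := mul_mem_ball hϖ (coeff_phi_mem hϖ hn a₂ d₂ d₁ hd₂ hd₁) hx₁ (c := 0) (by ring)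
    convert! (ball ϖ 0).sub_mem h3 h4 using 1
    ring
  -- the increment of `φ` produced by a translation in `U_n`
  have hinc : ∀ (y r : k), y ∈ ball ϖ n → y * r ∈ ball ϖ (-1) → ∀ u : U ϖ n,
      U.toField u = 1 + y → ∀ a d : U ϖ n,
      (phi (a * u * d) - phi (a * d)) * r - 2 * y * r ∈ ball ϖ 0 := by
    intro y r hy hyr u hu a d
    have h3 := phi_increment hϖ (h1 (a * d)) (ball_anti hϖ (by exact_mod_cast hn) hy) hyr
    rw [← hu, ← U.toField_mul, mul_right_comm a d u] at h3
    exact h3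
  have hex : ∀ r : k, r ∉ ball ϖ (-n) →
      ∃ y ∈ ball ϖ n, y * r ∈ ball ϖ (-1) ∧ Ψ (2 * y * r) ≠ 1 := by
    intro r hr
    have h3 : 2 * r ∉ ball ϖ (-n) := by rwa [mul_mem_ball_iff h2]
    obtain ⟨y, hy, hyr, hne⟩ := exists_char_ne_one Ψ hϖ hΨ' h3
    rw [neg_neg] at hy
    rw [mul_assoc, mul_mem_ball_iff h2, mul_comm] at hyr
    refine ⟨y, hy, hyr, ?_⟩
    convert! hne using 2
    ring
  have hmul : ∀ (a u : U ϖ n) (x : k), (⟨a, Submodule.Quotient.mk x⟩ : X ϖ n) * ⟨u, 0⟩ =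
      ⟨a * u, Submodule.Quotient.mk (U.toField u⁻¹ * x)⟩ := by
    intro a u x
    ext1
    · rfl
    · rw [X.mul_t, add_zero]
      rfl
  have hmem : ∀ u : U ϖ n, (⟨u, 0⟩ : X ϖ n) ∈ largeX hϖ hn hm := fun u =>
    (gamBall ϖ n m).zero_mem
  have hinv : ∀ (u : U ϖ n) {x : k}, x ∈ ball ϖ (-m) → U.toField u⁻¹ * x ∈ ball ϖ (-m) :=
    fun u x hx => (mul_mem_ball_iff (val_toField hϖ hn _)).mpr hx
  obtain ⟨u₁, u₂, y, hy, hmain⟩ : ∃ (u₁ u₂ : U ϖ n) (y : k), Ψ y ≠ 1 ∧ ∀ a₁ a₂ : U ϖ n,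
      (phi (a₂ * u₂ * d₂) * r₁ - phi (a₁ * u₁ * d₁) * r₂) -
        (y + (phi (a₂ * d₂) * r₁ - phi (a₁ * d₁) * r₂)) ∈ ball ϖ 0 := by
    by_cases hr₁ : r₁ ∈ ball ϖ (-n)
    · obtain ⟨y, hyn, hyr, hne⟩ := hex r₂ fun h => hr ⟨hr₁, h⟩
      obtain ⟨u, hu⟩ := exists_U_toField hϖ hn hyn
      refine ⟨u, 1, -(2 * y * r₂), fun h => hne ?_, fun a₁ a₂ => ?_⟩
      · rwa [AddChar.map_neg_eq_inv, inv_eq_one] at h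
      · convert! (ball ϖ 0).neg_mem (hinc y r₂ hyn hyr u hu a₁ d₁) using 1
        rw [mul_one]
        ring
    · obtain ⟨y, hyn, hyr, hne⟩ := hex r₁ hr₁
      obtain ⟨u, hu⟩ := exists_U_toField hϖ hn hyn
      refine ⟨1, u, 2 * y * r₁, hne, fun a₁ a₂ => ?_⟩
      convert! hinc y r₁ hyn hyr u hu a₂ d₂ using 1
      rw [mul_one]
      ring
  refine ⟨(⟨u₁, 0⟩, ⟨u₂, 0⟩), ⟨hmem _, hmem _⟩, (Ψ y : ℂ), fun h => hy (Circle.ext h), ?_⟩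
  rintro ⟨⟨a₁, x₁⟩, ⟨a₂, x₂⟩⟩ ⟨hx₁, hx₂⟩
  obtain ⟨x₁, rfl⟩ := Submodule.Quotient.mk_surjective _ x₁
  obtain ⟨x₂, rfl⟩ := Submodule.Quotient.mk_surjective _ x₂
  replace hx₁ := (mk_mem_gamBall hϖ hm).mp hx₁
  replace hx₂ := (mk_mem_gamBall hϖ hm).mp hx₂
  rw [hQ _ _ _ _ hx₁ hx₂, Prod.mk_mul_mk, hmul, hmul, hQ _ _ _ _ (hinv _ hx₁) (hinv _ hx₂),
    ← Circle.coe_mul, ← AddChar.map_add_eq_mul]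
  congr 1
  exact char_eq_of_sub_mem (ϖ := ϖ) hΨ (hmain a₁ a₂)

end Subgroups

/-! ### The topology and the Haar measure of `X_n` -/

section Topology

open Topology

variable {k : Type*} [Field k] [ValuativeRel k] {ϖ : 𝒪[k]} {n m : ℕ}

theorem injective_toField : Function.Injective (U.toField : U ϖ n → k) := fun _ _ h =>
  Subtype.ext (Units.ext (Subtype.ext h))

variable [TopologicalSpace k]

theorem isInducing_equivProd : IsInducing (X.equivProd ϖ n) := ⟨rfl⟩

variable [IsNonarchimedeanLocalField k]

theorem isInducing_toField : IsInducing (U.toField : U ϖ n → k) := by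
  have h1 : IsInducing (Units.val : 𝒪[k]ˣ → 𝒪[k]) := by
    refine (Units.isEmbedding_val_mk' (f := Ring.inverse) ?_ fun u => Ring.inverse_unit u).1
    rw [IsInducing.subtypeVal.continuousOn_iff]
    have h2 : ContinuousOn (fun x : 𝒪[k] => (x : k)⁻¹) {x | IsUnit x} := by
      refine ContinuousOn.inv₀ continuous_subtype_val.continuousOn fun x hx => ?_
      have := IsUnit.ne_zero hx
      exact fun h => this (Subtype.ext h)
    refine h2.congr fun x hx => ?_
    obtain ⟨u, rfl⟩ := hx
    rw [Function.comp_apply, Ring.inverse_unit]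
    refine eq_inv_of_mul_eq_one_left ?_
    rw [← Subring.coe_mul, Units.inv_mul, Subring.coe_one]
  exact IsInducing.subtypeVal.comp (h1.comp IsInducing.subtypeVal)

theorem mem_range_toField (hϖ : Irreducible ϖ) (hn : 1 ≤ n) {x : k} :
    x ∈ Set.range (U.toField : U ϖ n → k) ↔ x - 1 ∈ ball ϖ n := by
  constructor
  · rintro ⟨a, rfl⟩
    exact U.sub_one_mem hϖ a
  · intro hx
    obtain ⟨u, hu⟩ := exists_U_toField hϖ hn hx
    exact ⟨u, by rw [hu]; ring⟩

theorem compactSpace_U (hϖ : Irreducible ϖ) (hn : 1 ≤ n) : CompactSpace (U ϖ n) := by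
  rw [← isCompact_univ_iff, isInducing_toField.isCompact_iff, Set.image_univ]
  have h1 : Set.range (U.toField : U ϖ n → k) = (fun x => x + 1) '' (ball ϖ n) := by
    ext x
    rw [mem_range_toField hϖ hn, Set.image_add_right, Set.mem_preimage, ← sub_eq_add_neg]
    rfl
  rw [h1]
  exact (isCompact_ball (n : ℤ)).image (by fun_prop)

theorem discreteTopology_Gam (hϖ : Irreducible ϖ) : DiscreteTopology (Gam ϖ n) := by
  refine QuotientAddGroup.discreteTopology (N := (fracIdeal ϖ n).toAddSubgroup) ?_
  convert! isOpen_ball hϖ (-n) using 1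
  ext x
  exact mem_fracIdeal hϖ

theorem countable_Gam (hϖ : Irreducible ϖ) : Countable (Gam ϖ n) := by
  have := secondCountableTopology hϖ
  have := discreteTopology_Gam (n := n) hϖ
  have hc : Continuous (Submodule.Quotient.mk : k → Gam ϖ n) := continuous_quot_mk
  have := (Submodule.Quotient.mk_surjective (fracIdeal ϖ n)).denseRange.separableSpace hc
  exact TopologicalSpace.separableSpace_iff_countable.mp this

theorem card_gamBall (hϖ : Irreducible ϖ) (N : ℕ) :
    Nat.card (gamBall ϖ n (n + N)) = Nat.card 𝓀[k] ^ N := by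
  have h1 : (fracIdeal ϖ n).mkQ.toAddMonoidHom.ker = ball ϖ (-n) := by
    ext x
    rw [AddMonoidHom.mem_ker]
    exact mk_eq_zero_iff hϖ
  rw [gamBall, ← AddSubgroup.relIndex_ker, h1, ← relIndex_ball hϖ (-(n + N : ℕ)) N]
  congr 2
  push_cast
  ring

theorem finite_gamBall (hϖ : Irreducible ϖ) (N : ℕ) :
    (gamBall ϖ n (n + N) : Set (Gam ϖ n)).Finite := by
  have : Finite (gamBall ϖ n (n + N)) :=
    Nat.finite_of_card_ne_zero (by rw [card_gamBall hϖ]; exact pow_ne_zero _ Nat.card_pos.ne')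
  exact Set.toFinite _

theorem r1Space_X : R1Space (X ϖ n) := by
  have : R1Space (U ϖ n) := isInducing_toField.r1Space
  exact isInducing_equivProd.r1Space

theorem secondCountableTopology_X (hϖ : Irreducible ϖ) : SecondCountableTopology (X ϖ n) := by
  have := secondCountableTopology hϖ
  have := discreteTopology_Gam (n := n) hϖ
  have := countable_Gam (n := n) hϖ
  have : SecondCountableTopology (U ϖ n) := isInducing_toField.secondCountableTopology
  exact isInducing_equivProd.secondCountableTopology

theorem mem_gamBall_of_le (hϖ : Irreducible ϖ) {N M : ℕ} (h : N ≤ M) {t : Gam ϖ n}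
    (ht : t ∈ gamBall ϖ n (n + N)) : t ∈ gamBall ϖ n (n + M) := by
  obtain ⟨t, rfl⟩ := Submodule.Quotient.mk_surjective _ t
  rw [mk_mem_gamBall hϖ (by lia)] at ht ⊢
  exact ball_anti hϖ (by lia) ht

theorem exists_mem_gamBall (hϖ : Irreducible ϖ) (t : Gam ϖ n) :
    ∃ N, t ∈ gamBall ϖ n (n + N) := by
  obtain ⟨t, rfl⟩ := Submodule.Quotient.mk_surjective _ t
  obtain ⟨N, hN⟩ := exists_mem_ball hϖ t
  refine ⟨N, ?_⟩
  rw [mk_mem_gamBall hϖ (by lia)]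
  exact ball_anti hϖ (by lia) hN

theorem nhds_U_basis (hϖ : Irreducible ϖ) (hn : 1 ≤ n) (a : U ϖ n) :
    (𝓝 a).HasBasis (fun _ : ℕ => True)
      fun N => {b | U.toField (a⁻¹ * b) - 1 ∈ ball ϖ (n + N : ℕ)} := by
  rw [isInducing_toField.nhds_eq_comap, ← nhds_translation_sub]
  refine (((nhds_zero_basis hϖ n).comap _).comap _).to_hasBasis
    (fun N _ => ⟨N, trivial, ?_⟩) (fun N _ => ⟨N, trivial, ?_⟩)
  all_goals
    intro b hb
    have h1 : U.toField b - U.toField a = U.toField a * (U.toField (a⁻¹ * b) - 1) := by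
      rw [mul_sub, ← U.toField_mul, mul_inv_cancel_left, mul_one]
    simp only [Set.mem_preimage, Set.mem_ofPred_eq, SetLike.mem_coe, h1,
      mul_mem_ball_iff (val_toField hϖ hn a)] at hb ⊢
    exact hb

open Pointwise in
/-- The coset of `g` under `U_m ⋉ 0`, for `g` with `t`-component in `ϖ⁻ᵐ 𝒪 / ϖ⁻ⁿ 𝒪`. -/
theorem smul_smallX (hϖ : Irreducible ϖ) (hn : 1 ≤ n) (hm : n ≤ m) {g : X ϖ n}
    (hg : g ∈ largeX hϖ hn hm) : g • (smallX hϖ hn m : Set (X ϖ n)) =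
      X.equivProd ϖ n ⁻¹' ({b | U.toField (g.a⁻¹ * b) - 1 ∈ ball ϖ m} ×ˢ {g.t}) := by
  ext h
  rw [Set.mem_smul_set_iff_inv_smul_mem, smul_eq_mul, SetLike.mem_coe, mem_smallX]
  refine and_congr_right fun h1 => ?_
  rw [X.mul_t, X.inv_t, smul_neg, smul_smul]
  have h2 : U.toField (h.a⁻¹ * g.a) - 1 ∈ ball ϖ m := by
    rw [show h.a⁻¹ * g.a = (g.a⁻¹ * h.a)⁻¹ by group, U.toField_inv]
    exact inv_sub_one_mem hϖ (ball_anti hϖ (by exact_mod_cast hn) (U.sub_one_mem hϖ _)) h1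
  rw [smul_eq_of_sub_one_mem hϖ hm h2 hg, neg_add_eq_zero, eq_comm]
  rfl

theorem largeX_eq_preimage (hϖ : Irreducible ϖ) (hn : 1 ≤ n) (hm : n ≤ m) :
    (largeX hϖ hn hm : Set (X ϖ n)) =
      X.equivProd ϖ n ⁻¹' (Set.univ ×ˢ (gamBall ϖ n m : Set (Gam ϖ n))) := by
  ext g
  exact (and_iff_right trivial).symm

open Pointwise in
theorem nhds_X_basis (hϖ : Irreducible ϖ) (hn : 1 ≤ n) (g : X ϖ n) :
    (𝓝 g).HasBasis (fun N : ℕ => g ∈ largeX hϖ hn (n.le_add_right N))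
      fun N => g • (smallX hϖ hn (n + N) : Set (X ϖ n)) := by
  have := discreteTopology_Gam (n := n) hϖ
  rw [isInducing_equivProd.nhds_eq_comap, nhds_prod_eq]
  have h1 := (nhds_U_basis hϖ hn g.a).prod (Filter.hasBasis_pure g.t)
  rw [← nhds_discrete (Gam ϖ n)] at h1
  refine (h1.comap (X.equivProd ϖ n)).to_hasBasis ?_ ?_
  · rintro ⟨N, _⟩ -
    obtain ⟨M, hM⟩ := exists_mem_gamBall hϖ g.t
    have hg : g ∈ largeX hϖ hn (n.le_add_right (max N M)) :=
      mem_gamBall_of_le hϖ (le_max_right N M) hM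
    refine ⟨max N M, hg, ?_⟩
    rw [smul_smallX hϖ hn (n.le_add_right _) hg]
    refine Set.preimage_mono (Set.prod_mono (fun b hb => ?_) subset_rfl)
    exact ball_anti hϖ (by simp) hb
  · intro N hg
    exact ⟨(N, ()), ⟨trivial, trivial⟩, (smul_smallX hϖ hn (n.le_add_right _) hg).ge⟩

theorem isCompact_largeX (hϖ : Irreducible ϖ) (hn : 1 ≤ n) (N : ℕ) :
    IsCompact (largeX hϖ hn (n.le_add_right N) : Set (X ϖ n)) := by
  have := compactSpace_U hϖ hn
  rw [isInducing_equivProd.isCompact_iff, largeX_eq_preimage,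
    Set.image_preimage_eq _ (X.equivProd ϖ n).surjective]
  exact isCompact_univ.prod (finite_gamBall hϖ N).isCompact

theorem exists_subset_largeX (hϖ : Irreducible ϖ) (hn : 1 ≤ n) {S : Set (X ϖ n)}
    (hS : IsCompact S) : ∃ N, S ⊆ largeX hϖ hn (n.le_add_right N) := by
  have := discreteTopology_Gam (n := n) hϖ
  have hc : Continuous (X.t : X ϖ n → Gam ϖ n) :=
    continuous_snd.comp isInducing_equivProd.continuous
  have hf : (X.t '' S).Finite := (hS.image hc).finite_of_discrete
  choose N hN using exists_mem_gamBall (n := n) hϖ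
  refine ⟨hf.toFinset.sup N, fun g hg => ?_⟩
  exact mem_gamBall_of_le hϖ (Finset.le_sup (by simpa using ⟨g, hg, rfl⟩)) (hN g.t)

theorem smallX_anti (hϖ : Irreducible ϖ) (hn : 1 ≤ n) : Antitone (smallX hϖ hn) :=
  fun _ _ h _ hg => ⟨ball_anti hϖ (Int.ofNat_le.mpr h) hg.1, hg.2⟩

open Pointwise in
theorem smul_coe_prod {G G' : Type*} [Group G] [Group G'] (x : G × G') (S : Subgroup G)
    (S' : Subgroup G') :
    x • ((S.prod S' : Subgroup (G × G')) : Set (G × G')) = (x.1 • (S : Set G)) ×ˢ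
      (x.2 • (S' : Set G')) := by
  ext y
  simp only [Set.mem_prod, Set.mem_smul_set_iff_inv_smul_mem]
  rfl

end Topology

section Measure

variable {k : Type*} [Field k] [ValuativeRel k] [MeasurableSpace k] {ϖ : 𝒪[k]} {n m : ℕ}

theorem measurableSpace_U :
    (Subtype.instMeasurableSpace : MeasurableSpace (U ϖ n)) =
      MeasurableSpace.comap U.toField ‹MeasurableSpace k› := by
  change MeasurableSpace.comap _ (MeasurableSpace.comap _ (MeasurableSpace.comap _ _)) = _
  rw [MeasurableSpace.comap_comp, MeasurableSpace.comap_comp]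
  rfl

theorem measurable_equivProd : Measurable (X.equivProd ϖ n) := Measurable.of_comap_le le_rfl

theorem measurableEmbedding_equivProd : MeasurableEmbedding (X.equivProd ϖ n) where
  injective := (X.equivProd ϖ n).injective
  measurable := measurable_equivProd
  measurableSet_image' := by
    rintro _ ⟨s, hs, rfl⟩
    rwa [Set.image_preimage_eq _ (X.equivProd ϖ n).surjective]

variable [TopologicalSpace k] [IsNonarchimedeanLocalField k] [BorelSpace k]

theorem borelSpace_U : BorelSpace (U ϖ n) := by
  refine ⟨measurableSpace_U.trans ?_⟩
  rw [isInducing_toField.eq_induced, borel_comap, ← BorelSpace.measurable_eq]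

theorem measurableEmbedding_toField (hϖ : Irreducible ϖ) (hn : 1 ≤ n) :
    MeasurableEmbedding (U.toField : U ϖ n → k) := by
  have hr : MeasurableSet (Set.range (U.toField : U ϖ n → k)) := by
    have : Set.range (U.toField : U ϖ n → k) = (fun x => x - 1) ⁻¹' (ball ϖ n) := by
      ext x
      exact mem_range_toField hϖ hn
    rw [this]
    exact ((isOpen_ball hϖ n).preimage (by fun_prop)).measurableSet
  refine ⟨injective_toField, ?_, ?_⟩
  · exact Measurable.of_comap_le measurableSpace_U.ge
  · intro s hs
    obtain ⟨t, ht, rfl⟩ : MeasurableSet[MeasurableSpace.comap U.toField ‹MeasurableSpace k›] s :=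
      by rw [← measurableSpace_U]; exact hs
    rw [Set.image_preimage_eq_inter_range]
    exact ht.inter hr

theorem discreteMeasurableSpace_Gam (hϖ : Irreducible ϖ) :
    DiscreteMeasurableSpace (Gam ϖ n) := by
  have := discreteTopology_Gam (n := n) hϖ
  have hc : Continuous (Submodule.Quotient.mk : k → Gam ϖ n) := continuous_quot_mk
  exact ⟨fun s => ((isOpen_discrete s).preimage hc).measurableSet⟩

theorem borelSpace_X (hϖ : Irreducible ϖ) : BorelSpace (X ϖ n) := by
  have := secondCountableTopology hϖ
  have := discreteTopology_Gam (n := n) hϖ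
  have := countable_Gam (n := n) hϖ
  have := discreteMeasurableSpace_Gam (n := n) hϖ
  have : BorelSpace (U ϖ n) := borelSpace_U
  refine ⟨?_⟩
  change MeasurableSpace.comap _ _ = _
  rw [BorelSpace.measurable_eq (α := U ϖ n × Gam ϖ n), borel_comap]

theorem haarX_preimage (μ : Measure k) (hϖ : Irreducible ϖ) (A : Set (U ϖ n)) (B : Set (Gam ϖ n)) :
    haarX μ ϖ n (X.equivProd ϖ n ⁻¹' (A ×ˢ B)) = haarU μ ϖ n A * Measure.count B := by
  have := countable_Gam (n := n) hϖ
  have := discreteMeasurableSpace_Gam (n := n) hϖ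
  rw [haarX, measurableEmbedding_equivProd.comap_apply,
    Set.image_preimage_eq _ (X.equivProd ϖ n).surjective, Measure.prod_prod]

variable {μ : Measure k} [μ.IsAddHaarMeasure]

theorem haarU_coset (hμ : μ (𝒪[k] : Set k) = 1) (hϖ : Irreducible ϖ) (hn : 1 ≤ n) (hm : n ≤ m)
    (a : U ϖ n) : haarU μ ϖ n {b | U.toField (a⁻¹ * b) - 1 ∈ ball ϖ m} =
      ENNReal.ofReal ((Nat.card 𝓀[k] : ℝ) ^ (-m : ℤ)) := by
  rw [← measure_ball hμ hϖ m, haarU, (measurableEmbedding_toField hϖ hn).comap_apply,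
    ← measure_preimage_add_right μ (-U.toField a) (ball ϖ m : Set k)]
  congr 1
  ext x
  rw [Set.mem_preimage, ← sub_eq_add_neg, SetLike.mem_coe]
  have h1 : ∀ b : U ϖ n, U.toField b - U.toField a =
      U.toField a * (U.toField (a⁻¹ * b) - 1) := fun b => by
    rw [mul_sub, ← U.toField_mul, mul_inv_cancel_left, mul_one]
  constructor
  · rintro ⟨b, hb, rfl⟩
    rwa [h1, mul_mem_ball_iff (val_toField hϖ hn a)]
  · intro hx
    have h2 : x - 1 ∈ ball ϖ n := by
      rw [show x - 1 = (x - U.toField a) + (U.toField a - 1) by ring]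
      exact (ball ϖ n).add_mem (ball_anti hϖ (Int.ofNat_le.mpr hm) hx) (U.sub_one_mem hϖ a)
    obtain ⟨b, rfl⟩ := (mem_range_toField hϖ hn).mpr h2
    rw [h1, mul_mem_ball_iff (val_toField hϖ hn a)] at hx
    exact ⟨b, hx, rfl⟩

theorem haarU_univ (hμ : μ (𝒪[k] : Set k) = 1) (hϖ : Irreducible ϖ) (hn : 1 ≤ n) :
    haarU μ ϖ n Set.univ = ENNReal.ofReal ((Nat.card 𝓀[k] : ℝ) ^ (-n : ℤ)) := by
  rw [← haarU_coset hμ hϖ hn le_rfl 1]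
  congr 1
  exact (Set.eq_univ_of_forall fun b => U.sub_one_mem hϖ _).symm

theorem haarX_largeX (hμ : μ (𝒪[k] : Set k) = 1) (hϖ : Irreducible ϖ) (hn : 1 ≤ n) (N : ℕ) :
    haarX μ ϖ n (largeX hϖ hn (n.le_add_right N)) =
      ENNReal.ofReal ((Nat.card 𝓀[k] : ℝ) ^ ((N : ℤ) - n)) := by
  have := discreteMeasurableSpace_Gam (n := n) hϖ
  have hq : (Nat.card 𝓀[k] : ℝ) ≠ 0 := by exact_mod_cast Nat.card_pos.ne'
  have h1 : (finite_gamBall (n := n) hϖ N).toFinset.card = Nat.card 𝓀[k] ^ N := by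
    rw [← card_gamBall (n := n) hϖ N, ← Set.ncard_eq_toFinset_card _ (finite_gamBall hϖ N)]
    rfl
  rw [largeX_eq_preimage, haarX_preimage μ hϖ, haarU_univ hμ hϖ hn,
    Measure.count_apply_finite _ (finite_gamBall hϖ N), h1, sub_eq_add_neg, zpow_add₀ hq,
    mul_comm, ENNReal.ofReal_mul (by positivity), zpow_natCast, ENNReal.ofReal_pow (by positivity),
    ENNReal.ofReal_natCast]
  push_cast
  rfl

open Pointwise in
theorem haarX_coset (hμ : μ (𝒪[k] : Set k) = 1) (hϖ : Irreducible ϖ) (hn : 1 ≤ n) (hm : n ≤ m)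
    {g : X ϖ n} (hg : g ∈ largeX hϖ hn hm) : haarX μ ϖ n (g • (smallX hϖ hn m : Set (X ϖ n))) =
      ENNReal.ofReal ((Nat.card 𝓀[k] : ℝ) ^ (-m : ℤ)) := by
  have := discreteMeasurableSpace_Gam (n := n) hϖ
  rw [smul_smallX hϖ hn hm hg, haarX_preimage μ hϖ, haarU_coset hμ hϖ hn hm,
    Measure.count_singleton, mul_one]

theorem sigmaFinite_haarX (hμ : μ (𝒪[k] : Set k) = 1) (hϖ : Irreducible ϖ) (hn : 1 ≤ n) :
    SigmaFinite (haarX μ ϖ n) :=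
  ⟨⟨{ set := fun N => largeX hϖ hn (n.le_add_right N)
      set_mem := fun _ => trivial
      finite := fun N => by rw [haarX_largeX hμ]; exact ENNReal.ofReal_lt_top
      spanning := Set.eq_univ_of_forall fun g =>
        Set.mem_iUnion.mpr (exists_mem_gamBall hϖ g.t) }⟩⟩

open Pointwise in
/-- The tower of compact open subgroups of `X_n × X_n`; level `N` belongs to the powers `ϖ^(n+N)`
and `ϖ^(-n-N)`. -/
def towerXX (hμ : μ (𝒪[k] : Set k) = 1) (hϖ : Irreducible ϖ) (hn : 1 ≤ n) :
    Tower (haarXX μ ϖ n) where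
  H N := (largeX hϖ hn (n.le_add_right N)).prod (largeX hϖ hn (n.le_add_right N))
  K N := (smallX hϖ hn (n + N)).prod (smallX hϖ hn (n + N))
  c N := (Nat.card 𝓀[k] : ℝ) ^ (-(n + N : ℕ) : ℤ) * (Nat.card 𝓀[k] : ℝ) ^ (-(n + N : ℕ) : ℤ)
  H_mono N M h := Subgroup.prod_mono (fun _ hg => mem_gamBall_of_le hϖ h hg)
    (fun _ hg => mem_gamBall_of_le hϖ h hg)
  K_anti N M h := by
    have h1 := smallX_anti hϖ hn (Nat.add_le_add_left h n)
    exact Subgroup.prod_mono h1 h1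
  K_le N := by
    have h1 : smallX hϖ hn (n + N) ≤ largeX (ϖ := ϖ) hϖ hn (n.le_add_right N) := fun g hg => by
      rw [mem_largeX, hg.2]
      exact (gamBall ϖ n (n + N)).zero_mem
    exact Subgroup.prod_mono h1 h1
  conj_mem N g hg u hu := ⟨conj_mem_smallX hϖ hn _ hg.1 hu.1, conj_mem_smallX hϖ hn _ hg.2 hu.2⟩
  nhds_basis x := by
    rw [nhds_prod_eq]
    refine ((nhds_X_basis hϖ hn x.1).prod (nhds_X_basis hϖ hn x.2)).to_hasBasis ?_ ?_
    · rintro ⟨N, M⟩ ⟨h1, h2⟩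
      refine ⟨max N M, ⟨mem_gamBall_of_le hϖ (le_max_left N M) h1,
        mem_gamBall_of_le hϖ (le_max_right N M) h2⟩, ?_⟩
      rw [smul_coe_prod]
      exact Set.prod_mono (Set.smul_set_mono (smallX_anti hϖ hn (by simp)))
        (Set.smul_set_mono (smallX_anti hϖ hn (by simp)))
    · exact fun N hx => ⟨(N, N), hx, (smul_coe_prod x _ _).ge⟩
  exhaust S hS := by
    obtain ⟨N, hN⟩ := exists_subset_largeX hϖ hn (hS.image continuous_fst)
    obtain ⟨M, hM⟩ := exists_subset_largeX hϖ hn (hS.image continuous_snd)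
    refine ⟨max N M, fun g hg => ⟨?_, ?_⟩⟩
    · exact mem_gamBall_of_le hϖ (le_max_left N M) (hN ⟨g, hg, rfl⟩)
    · exact mem_gamBall_of_le hϖ (le_max_right N M) (hM ⟨g, hg, rfl⟩)
  c_pos N := by
    have : (0 : ℝ) < Nat.card 𝓀[k] := by exact_mod_cast Nat.card_pos
    positivity
  measure_coset N x hx := by
    have := sigmaFinite_haarX hμ hϖ hn
    rw [smul_coe_prod, Measure.prod_prod, haarX_coset hμ hϖ hn _ hx.1, haarX_coset hμ hϖ hn _ hx.2,
      ENNReal.ofReal_mul (by positivity)]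
  measure_H N := by
    have := sigmaFinite_haarX hμ hϖ hn
    rw [Subgroup.coe_prod, Measure.prod_prod, haarX_largeX hμ]
    exact ENNReal.mul_ne_top ENNReal.ofReal_ne_top ENNReal.ofReal_ne_top
  isCompact_H N := by
    rw [Subgroup.coe_prod]
    exact (isCompact_largeX hϖ hn N).prod (isCompact_largeX hϖ hn N)

end Measure

/-! ### The cocycle as a convolution form -/

section Cocycle

variable {k : Type*} [Field k] [ValuativeRel k] [MeasurableSpace k] {ϖ : 𝒪[k]} {n : ℕ}
  {μ : Measure k}

theorem cocycleIntegrand_eq (Ψ : AddChar k Circle) (h f : X ϖ n × X ϖ n → ℂ) :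
    cocycleIntegrand μ Ψ h f = Tower.convIntegrand (haarXX μ ϖ n) (phase Ψ) h f := by
  funext g
  simp only [cocycleIntegrand, Tower.convIntegrand, leftTranslate, inv_inv]
  rfl

variable [TopologicalSpace k] [IsNonarchimedeanLocalField k] [BorelSpace k] [μ.IsAddHaarMeasure]

/-- The normalisation `q^{2n}` makes the convolution matrices unitary. -/
theorem normalisation (hμ : μ (𝒪[k] : Set k) = 1) (hϖ : Irreducible ϖ) (hn : 1 ≤ n) (N : ℕ) :
    ((Nat.card 𝓀[k] : ℝ) ^ (2 * n)) ^ 2 * (towerXX hμ hϖ hn).c N *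
      (haarXX μ ϖ n).real ((towerXX hμ hϖ hn).H N) = 1 := by
  have := sigmaFinite_haarX hμ hϖ hn
  have hq : (Nat.card 𝓀[k] : ℝ) ≠ 0 := by exact_mod_cast Nat.card_pos.ne'
  have h1 : (haarXX μ ϖ n).real ((towerXX hμ hϖ hn).H N) =
      (Nat.card 𝓀[k] : ℝ) ^ ((N : ℤ) - n) * (Nat.card 𝓀[k] : ℝ) ^ ((N : ℤ) - n) := by
    rw [Measure.real, towerXX, Subgroup.coe_prod, Measure.prod_prod, haarX_largeX hμ,
      ENNReal.toReal_mul, ENNReal.toReal_ofReal (by positivity)]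
  rw [h1]
  simp only [towerXX]
  rw [← zpow_natCast, ← zpow_natCast, ← zpow_mul, ← zpow_add₀ hq, ← zpow_add₀ hq, ← zpow_add₀ hq,
    ← zpow_add₀ hq, ← zpow_zero (Nat.card 𝓀[k] : ℝ)]
  congr 1
  push_cast
  ring

theorem exists_twist (hchar : ¬ CharP k 2) (hQ2 : ¬ ∃ i : ℚ_[2] →+* k, Continuous i)
    {Ψ : AddChar k Circle} (hμ : μ (𝒪[k] : Set k) = 1) (hϖ : Irreducible ϖ) (hn : 1 ≤ n)
    (hΨ : ∀ x ∈ 𝒪[k], Ψ x = 1) (hΨ' : ∃ x ∈ 𝒪[k], Ψ ((ϖ : k)⁻¹ * x) ≠ 1) (N : ℕ)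
    (m : X ϖ n × X ϖ n) (hm : m ∉ (towerXX hμ hϖ hn).K N) :
    ∃ L ≤ (towerXX hμ hϖ hn).H N, ∀ g ∈ (towerXX hμ hϖ hn).H N, ∃ t ∈ L, ∃ ζ : ℂ, ζ ≠ 1 ∧
      ∀ s ∈ L, phase Ψ (g * s * t) * starRingEnd ℂ (phase Ψ (g * s * t * m)) =
        ζ * (phase Ψ (g * s) * starRingEnd ℂ (phase Ψ (g * s * m))) := by
  have h2 := val_two hϖ hchar hQ2
  have hN : n ≤ n + N := n.le_add_right N
  by_cases hd : U.toField m.1.a - 1 ∈ ball ϖ (n + N : ℕ) ∧ U.toField m.2.a - 1 ∈ ball ϖ (n + N : ℕ)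
  · obtain ⟨t, ht, ζ, hζ, h⟩ := exists_twist_of_mem hϖ h2 hn hN hΨ hΨ' m hd.1 hd.2
      fun h => hm ⟨⟨hd.1, h.1⟩, ⟨hd.2, h.2⟩⟩
    exact ⟨_, le_rfl, fun g hg => ⟨t, ht, ζ, hζ, fun s hs => h _ (Subgroup.mul_mem _ hg hs)⟩⟩
  · exact ⟨transX hϖ hn hN, fun _ h => h.1, fun g _ =>
      exists_twist_of_not_mem hϖ h2 hn hN hΨ hΨ' m hd g⟩

end Cocycle

end FuchsCocycle

end

theorem theorem1 {k : Type*} [Field k] [ValuativeRel k] [TopologicalSpace k]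
    [IsNonarchimedeanLocalField k] [MeasurableSpace k] [BorelSpace k]
    (hchar : ¬ CharP k 2) (hQ2 : ¬ ∃ i : ℚ_[2] →+* k, Continuous i)
    (μ : Measure k) [μ.IsAddHaarMeasure] (hμ : μ (𝒪[k] : Set k) = 1)
    (ϖ : 𝒪[k]) (hϖ : Irreducible ϖ)
    (Ψ : AddChar k Circle) (hΨc : Continuous Ψ) (hΨ : ∀ x ∈ 𝒪[k], Ψ x = 1)
    (hΨ' : ∃ x ∈ 𝒪[k], Ψ ((ϖ : k)⁻¹ * x) ≠ 1)
    (n : ℕ) (hn : 1 ≤ n) :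
    (∀ f : FuchsCocycle.X ϖ n × FuchsCocycle.X ϖ n → ℂ, FuchsCocycle.IsBruhat f →
      MemLp f 2 (FuchsCocycle.haarXX μ ϖ n)) ∧
    (∀ h f : FuchsCocycle.X ϖ n × FuchsCocycle.X ϖ n → ℂ,
      FuchsCocycle.IsBruhat h → FuchsCocycle.IsBruhat f →
      Integrable (FuchsCocycle.cocycleIntegrand μ Ψ h f) (FuchsCocycle.haarXX μ ϖ n)) ∧
    ∃ F ∈ unitary (Lp ℂ 2 (FuchsCocycle.haarXX μ ϖ n) →L[ℂ] Lp ℂ 2 (FuchsCocycle.haarXX μ ϖ n)),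
      FuchsCocycle.ExtendsCocycle μ Ψ F ∧
      ∀ T : Lp ℂ 2 (FuchsCocycle.haarXX μ ϖ n) →L[ℂ] Lp ℂ 2 (FuchsCocycle.haarXX μ ϖ n),
        FuchsCocycle.ExtendsCocycle μ Ψ T → T = F := by
  have := FuchsCocycle.borelSpace_X (n := n) hϖ
  have := FuchsCocycle.r1Space_X (ϖ := ϖ) (n := n)
  have := FuchsCocycle.secondCountableTopology_X (n := n) hϖ
  let T := FuchsCocycle.towerXX hμ hϖ hn
  have hP : ∀ N, ∀ g ∈ T.H N, ∀ u ∈ T.K N,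
      FuchsCocycle.phase Ψ (g * u) = FuchsCocycle.phase Ψ g := fun N g hg u hu =>
    FuchsCocycle.phase_mul_small hϖ hn (n.le_add_right N) hΨ g u hg hu
  refine ⟨fun f hf => T.memLp_of_isBruhat hf, fun h f hh hf => ?_, ?_⟩
  · obtain ⟨N, hN⟩ := FuchsCocycle.Tower.IsLevel.of_isBruhat (T := T) hh
    obtain ⟨M, hM⟩ := FuchsCocycle.Tower.IsLevel.of_isBruhat (T := T) hf
    rw [FuchsCocycle.cocycleIntegrand_eq]
    exact (FuchsCocycle.Tower.isLevel_convIntegrand (hP (max N M)) (hN.mono (le_max_left N M))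
      (hM.mono (le_max_right N M))).integrable
  · obtain ⟨F, hF, hFB, hFu⟩ := T.exists_unique_unitary_of_convIntegrand
      (FuchsCocycle.norm_phase Ψ) hP
      (fun N m _ hm => FuchsCocycle.exists_twist hchar hQ2 hμ hϖ hn hΨ hΨ' N m hm)
      (FuchsCocycle.normalisation hμ hϖ hn)
    have hform : ∀ h f, FuchsCocycle.cocycleForm μ Ψ h f =
        ((Nat.card 𝓀[k] : ℝ) ^ (2 * n) : ℝ) * ∫ g, FuchsCocycle.Tower.convIntegrand
          (FuchsCocycle.haarXX μ ϖ n) (FuchsCocycle.phase Ψ) h f g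
          ∂(FuchsCocycle.haarXX μ ϖ n) := by
      intro h f
      rw [FuchsCocycle.cocycleForm, FuchsCocycle.cocycleIntegrand_eq]
      push_cast
      rfl
    refine ⟨F, hF, fun h f hh hf v u hv hu => ?_, fun S hS => hFu S fun h f => ?_⟩
    · obtain rfl : v = T.toL2 ⟨h, hh⟩ := Lp.ext (hv.trans (T.toL2_ae_eq ⟨h, hh⟩).symm)
      obtain rfl : u = T.toL2 ⟨f, hf⟩ := Lp.ext (hu.trans (T.toL2_ae_eq ⟨f, hf⟩).symm)
      rw [hFB, hform]
    · rw [← hform]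
      exact hS h f h.2 f.2 _ _ (T.toL2_ae_eq h) (T.toL2_ae_eq f)
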